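/- **Bicategories of relations.** A bicategory of relations is a category $\mathcal B$ whose hom-sets are partially ordered, the order $R \Rightarrow S$ being preserved by composition, with a symmetric monoidal structure $(\otimes, I, \sigma)$ such that $\otimes$ preserves the order in each variable, and with a cocommutative comonoid structure $\Delta_X : X \to X\otimes X$, $\lozenge_X : X \to I$ on each object such that (up to associators and unitors, composition being written in diagrammatic order) $$\lozenge_I = 1_I,\quad \Delta_I = (I \cong I\otimes I),\quad \lozenge_{X\otimes Y}=\lozenge_X\otimes\lozenge_Y,\quad \Delta_{X\otimes Y} = (\Delta_X\otimes\Delta_Y)(1_X\otimes\sigma_{X,Y}\otimes 1_Y);$$ every $R: X\to Y$ satisfies $R\,\Delta_Y \Rightarrow \Delta_X(R\otimes R)$ and $R\,\lozenge_Y\Rightarrow \lozenge_X$; the morphisms $\Delta_X$ and $\lozenge_X$ have right adjoints $\nabla_X$ and $\square_X$ (i.e. $1\Rightarrow\Delta_X\nabla_X$, $\nabla_X\Delta_X\Rightarrow 1$, $1\Rightarrow\lozenge_X\square_X$, $\square_X\lozenge_X\Rightarrow 1$); and $(1_X\otimes\Delta_X)(\nabla_X\otimes 1_X)=\nabla_X\Delta_X=(\Delta_X\otimes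 1_X)(1_X\otimes\nabla_X)$. A structure-preserving functor is a strong symmetric monoidal functor that preserves the order and, modulo its comparison isomorphisms, the morphisms $\Delta$ and $\lozenge$. An equivalence in $\mathbf{BiRel}$ is an adjoint equivalence of categories whose two functors are structure-preserving and whose unit and counit are monoidal. **Regular logic.** A signature consists of basic types and of relation symbols $R:(A_1,\dots,A_n)$. Formulas in a context $\Gamma=(x_1:A_1,\dots,x_n:A_n)$ are built from atoms $R(\vec x)$ and equations $x=y$ between variables of the same type by $\top$, $\wedge$ and $\exists x:A$. A regular theory $T$ is a set of sequents $\Gamma\mid\varphi\vdash\psi$; entailment $\vdash_T$ is deducibility from $T$ by the rules: identity; cut; substitution of variables; $\varphi\vdash x=x$ and $(\vec x=\vec y)\wedge\varphi\vdash\varphi[\vec y/\vec x]$; $\varphi\vdash\top$; introduction and elimination of $\wedge$; the two-way rule between $\Gamma,x:A\mid\varphi\vdash\psi$ and $\Gamma\mid\exists x:A.\varphi\vdash\psi$ (for $\psi$ in context $\Gamma$); and $\varphi\wedge\exists x:A.\psi\vdash\exists x:A.(\varphi\wedge\psi)$ for $x \notin \Gamma$. **Classifying category.** $\mathrm{Cl}(T)$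 has as objects the finite lists of basic types and as morphisms $\vec A\to\vec B$ the classes $[\vec x:\vec A;\vec y:\vec B\mid\varphi]$ of formulas in context up to renaming of variables and $\dashv\vdash_T$, ordered by $\vdash_T$. Its structure is: composition $\exists\vec y.(\varphi\wedge\psi)$; identities $\vec x=\vec x'$; $\otimes$ is concatenation of lists and, on morphisms, conjunction; $I=()$; $\sigma=[\vec x,\vec y;\vec y',\vec x'\mid \vec x=\vec x'\wedge\vec y=\vec y']$; $\Delta=[\vec x;\vec x',\vec x''\mid\vec x=\vec x'\wedge\vec x=\vec x'']$; $\lozenge=[\vec x\mid\top]$. It is a bicategory of relations. **Internal language.** Let $\mathcal B$ be a small bicategory of relations. $\mathrm{Lang}(\mathcal B)$ has the objects of $\mathcal B$ as basic types and a relation symbol $R:(A_1,\dots,A_n)$ for each morphism $R: A_1\otimes\cdots\otimes A_n\to I$. Each formula in a context $\Gamma=\vec x:\vec A$ has an interpretation $[\![\Gamma\mid\varphi]\!]: A_1\otimes\cdots\otimes A_n\to I$: variables are copied and discarded with $\Delta$ and $\lozenge$, an atom $R(\vec x)$ is interpreted by $R$, equality of two variables of type $A$ by $\nabla_A\lozenge_A$,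 $\top$ by $\lozenge$, $\varphi\wedge\psi$ by $\Delta\,([\![\varphi]\!]\otimes[\![\psi]\!])\nabla_I$, and $\exists x:A$ by composing the input wire $x$ with $\square_A$. The axioms of $\mathrm{Lang}(\mathcal B)$ are all sequents $\Gamma\mid\varphi\vdash\psi$ such that $[\![\Gamma\mid\varphi]\!]\Rightarrow[\![\Gamma\mid\psi]\!]$ in $\mathcal B$. **Theorem.** For every small bicategory of relations $\mathcal B$, the bicategory of relations $\mathrm{Cl}(\mathrm{Lang}(\mathcal B))$ is strict monoidal, and there is an equivalence $$\mathrm{Cl}(\mathrm{Lang}(\mathcal B))\simeq\mathcal B\qquad\text{in } \mathbf{BiRel}.$$ If moreover $\mathcal B$ is strict monoidal, the functor $\mathrm{Cl}(\mathrm{Lang}(\mathcal B))\to\mathcal B$ can be chosen to be strict monoidal. -/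

import Mathlib

open CategoryTheory MonoidalCategory

universe u v u₁ v₁ u₂ v₂

/-! ### Bicategories of relations -/

section BicategoriesOfRelations

open scoped ComonObj

/-- A bicategory of relations: a locally posetal 2-category (the 2-morphisms `R ⟹ S` are the
inequalities `R ≤ S` of a partial order on each hom-set, preserved by composition) which is
symmetric monoidal (the tensor product being a 2-functor) and has diagonals
(`CopyDiscardCategory`: a cocommutative comonoid `Δ[X]`, `ε[X]` on each object, coherent with the
monoidal structure), such that every morphism is a lax comonoid homomorphism, `Δ[X]` and `ε[X]`
have right adjoints `merge X` and `create X`, and the Frobenius equations hold. -/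
class BicategoryOfRelations (C : Type u) [Category.{v} C] [MonoidalCategory C]
    extends CopyDiscardCategory C where
  homOrder (X Y : C) : PartialOrder (X ⟶ Y)
  comp_mono {X Y Z : C} {R R' : X ⟶ Y} {S S' : Y ⟶ Z} :
    R ≤ R' → S ≤ S' → R ≫ S ≤ R' ≫ S'
  tensor_mono {X Y Z W : C} {R R' : X ⟶ Y} {S S' : Z ⟶ W} :
    R ≤ R' → S ≤ S' → R ⊗ₘ S ≤ R' ⊗ₘ S'
  lax_copy {X Y : C} (R : X ⟶ Y) : R ≫ Δ[Y] ≤ Δ[X] ≫ (R ⊗ₘ R)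
  lax_discard {X Y : C} (R : X ⟶ Y) : R ≫ ε[Y] ≤ ε[X]
  /-- The right adjoint of `Δ[X]`. -/
  merge (X : C) : X ⊗ X ⟶ X
  /-- The right adjoint of `ε[X]`. -/
  create (X : C) : 𝟙_ C ⟶ X
  id_le_copy_merge (X : C) : 𝟙 X ≤ Δ[X] ≫ merge X
  merge_copy_le_id (X : C) : merge X ≫ Δ[X] ≤ 𝟙 (X ⊗ X)
  id_le_discard_create (X : C) : 𝟙 X ≤ ε[X] ≫ create X
  create_discard_le_id (X : C) : create X ≫ ε[X] ≤ 𝟙 (𝟙_ C)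
  frobenius_left (X : C) : X ◁ Δ[X] ≫ (α_ X X X).inv ≫ merge X ▷ X = merge X ≫ Δ[X]
  frobenius_right (X : C) : Δ[X] ▷ X ≫ (α_ X X X).hom ≫ X ◁ merge X = merge X ≫ Δ[X]

attribute [reducible] BicategoryOfRelations.homOrder
attribute [instance] BicategoryOfRelations.homOrder

namespace BicategoryOfRelations

section Functors

variable {C : Type u₁} [Category.{v₁} C] [MonoidalCategory C] [BicategoryOfRelations C]
variable {D : Type u₂} [Category.{v₂} D] [MonoidalCategory D] [BicategoryOfRelations D]

open Functor.OplaxMonoidal in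
/-- A (strong) symmetric monoidal functor between bicategories of relations is structure-preserving
if it preserves 2-morphisms and diagonals.  (Right adjoints of the diagonals, being unique, are
then preserved as well.) -/
class StructurePreserving (F : C ⥤ D) [F.Braided] : Prop where
  map_mono {X Y : C} {R S : X ⟶ Y} : R ≤ S → F.map R ≤ F.map S
  map_copy (X : C) : F.map Δ[X] ≫ δ F X X = Δ[F.obj X]
  map_discard (X : C) : F.map ε[X] ≫ η F = ε[F.obj X]

variable (C D) in
/-- An equivalence in the 2-category of bicategories of relations and structure-preserving functors:
structure-preserving functors in both directions, mutually inverse up to monoidal natural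
isomorphism. -/
structure BiRelEquivalence where
  toEquivalence : C ≌ D
  [functor_braided : toEquivalence.functor.Braided]
  [inverse_braided : toEquivalence.inverse.Braided]
  [isMonoidal : toEquivalence.IsMonoidal]
  functor_structurePreserving : StructurePreserving toEquivalence.functor
  inverse_structurePreserving : StructurePreserving toEquivalence.inverse

attribute [instance] BiRelEquivalence.functor_braided BiRelEquivalence.inverse_braided

end Functors

end BicategoryOfRelations

end BicategoriesOfRelations

/-- A monoidal category is strict if the tensor product is associative and unital on the nose and
the structure isomorphisms are identities. -/
class IsStrictMonoidal (C : Type u) [Category.{v} C] [MonoidalCategory C] : Prop where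
  tensor_assoc (X Y Z : C) : (X ⊗ Y) ⊗ Z = X ⊗ (Y ⊗ Z)
  unit_tensor (X : C) : 𝟙_ C ⊗ X = X
  tensor_unit (X : C) : X ⊗ 𝟙_ C = X
  associator_hom (X Y Z : C) : (α_ X Y Z).hom = eqToHom (tensor_assoc X Y Z)
  leftUnitor_hom (X : C) : (λ_ X).hom = eqToHom (unit_tensor X)
  rightUnitor_hom (X : C) : (ρ_ X).hom = eqToHom (tensor_unit X)

/-- A monoidal functor is strict if it preserves tensor product and unit on the nose, its
comparison morphisms being identities. -/
class IsStrictMonoidalFunctor {C : Type u₁} [Category.{v₁} C] [MonoidalCategory C]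
    {D : Type u₂} [Category.{v₂} D] [MonoidalCategory D] (F : C ⥤ D) [F.Monoidal] : Prop where
  obj_unit : 𝟙_ D = F.obj (𝟙_ C)
  obj_tensor (X Y : C) : F.obj X ⊗ F.obj Y = F.obj (X ⊗ Y)
  ε_eq : Functor.LaxMonoidal.ε F = eqToHom obj_unit
  μ_eq (X Y : C) : Functor.LaxMonoidal.μ F X Y = eqToHom (obj_tensor X Y)

/-! ### Regular logic -/

namespace RegularLogic

/-- A multisorted relational signature. -/
structure Signature where
  /-- basic types -/
  Ty : Type u
  /-- relation symbols -/
  Rel : Type v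
  /-- the list of argument types of a relation symbol -/
  arity : Rel → List Ty

section Variables

variable {T : Type u}

/-- `Var Γ A` is the type of variables of type `A` in the context `Γ`.  Contexts are taken up to
renaming of variables, so a context is a list of types and a variable is a position in it. -/
inductive Var : List T → T → Type u
  | zero {Γ : List T} {A : T} : Var (A :: Γ) A
  | succ {Γ : List T} {A B : T} : Var Γ A → Var (B :: Γ) A

/-- `Ren Γ Δ` consists of the tuples of variables of `Δ` with types listed in `Γ`, equivalently
type-preserving substitutions of variables (which are the only terms) of `Δ` for those of `Γ`. -/
abbrev Ren (Γ Δ : List T) : Type u := ∀ ⦃A : T⦄, Var Γ A → Var Δ A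

namespace Ren

variable {Γ Δ Θ Ξ : List T}

/-- The identity substitution. -/
def id (Γ : List T) : Ren Γ Γ := fun _ x => x

/-- Composition of substitutions. -/
def comp (σ : Ren Γ Δ) (τ : Ren Δ Θ) : Ren Γ Θ := fun _ x => τ (σ x)

/-- Weakening by one variable. -/
def wk (A : T) : Ren Γ (A :: Γ) := fun _ x => x.succ

/-- The empty tuple. -/
def nil : Ren [] Γ := fun _ x => nomatch x

/-- Extension of a tuple by a variable. -/
def cons {A : T} (x : Var Δ A) (σ : Ren Γ Δ) : Ren (A :: Γ) Δ
  | _, .zero => x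
  | _, .succ y => σ y

/-- The tail of a tuple. -/
def tail {A : T} (σ : Ren (A :: Γ) Δ) : Ren Γ Δ := fun _ x => σ x.succ

/-- Extension of a substitution to one more (bound) variable. -/
def lift (A : T) (σ : Ren Γ Δ) : Ren (A :: Γ) (A :: Δ) := cons .zero (σ.comp (wk A))

/-- The inclusion of the left part of a context. -/
def inl : ∀ {Γ : List T} (Δ : List T), Ren Γ (Γ ++ Δ)
  | _ :: _, _, _, .zero => .zero
  | _ :: _, Δ, _, .succ x => .succ (inl Δ x)

/-- The inclusion of the right part of a context. -/
def inr : ∀ (Γ : List T) {Δ : List T}, Ren Δ (Γ ++ Δ)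
  | [], _, _, x => x
  | _ :: Γ, _, _, x => .succ (inr Γ x)

/-- Concatenation of tuples. -/
def app : ∀ {Γ Δ Ξ : List T}, Ren Γ Ξ → Ren Δ Ξ → Ren (Γ ++ Δ) Ξ
  | [], _, _, _, τ => τ
  | _ :: _, _, _, σ, τ => cons (σ .zero) (app (tail σ) τ)

end Ren

end Variables

/-- Formulas in context of regular logic over a signature, up to renaming of variables.  In
`Formula.ex A φ`, the bound variable is the first variable of the context of `φ`. -/
inductive Formula (S : Signature.{u, v}) : List S.Ty → Type (max u v)
  | rel {Γ : List S.Ty} (R : S.Rel) (x : Ren (S.arity R) Γ) : Formula S Γ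
  | eq {Γ : List S.Ty} {A : S.Ty} (x y : Var Γ A) : Formula S Γ
  | top {Γ : List S.Ty} : Formula S Γ
  | and {Γ : List S.Ty} (φ ψ : Formula S Γ) : Formula S Γ
  | ex {Γ : List S.Ty} (A : S.Ty) (φ : Formula S (A :: Γ)) : Formula S Γ

namespace Formula

variable {S : Signature.{u, v}}

/-- Simultaneous substitution of variables in a formula. -/
def subst : ∀ {Γ Δ : List S.Ty}, Ren Γ Δ → Formula S Γ → Formula S Δ
  | _, _, σ, rel R x => rel R (x.comp σ)
  | _, _, σ, eq x y => eq (σ x) (σ y)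
  | _, _, _, top => top
  | _, _, σ, and φ ψ => and (subst σ φ) (subst σ ψ)
  | _, _, σ, ex A φ => ex A (subst (σ.lift A) φ)

/-- The conjunction `x₁ = y₁ ∧ ⋯ ∧ xₙ = yₙ` for two tuples of variables of the same types. -/
def eqs {Γ : List S.Ty} : ∀ {Θ : List S.Ty}, Ren Θ Γ → Ren Θ Γ → Formula S Γ
  | [], _, _ => top
  | _ :: _, x, y => and (eq (x .zero) (y .zero)) (eqs x.tail y.tail)

/-- Existential quantification over the variables of an initial part of the context. -/
def exs {Γ : List S.Ty} : ∀ {Θ : List S.Ty}, Formula S (Θ ++ Γ) → Formula S Γ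
  | [], φ => φ
  | A :: _, φ => exs (ex A φ)

end Formula

/-- A sequent `Γ ∣ φ ⊢ ψ`. -/
structure Sequent (S : Signature.{u, v}) where
  ctx : List S.Ty
  hyp : Formula S ctx
  concl : Formula S ctx

/-- A regular theory: a signature and a set of sequents over it, its axioms. -/
structure RegularTheory where
  sig : Signature.{u, v}
  ax : Set (Sequent sig)

open Formula in
/-- `Entails T φ ψ`: the sequent `Γ ∣ φ ⊢ ψ` is deducible from the axioms of `T` by the inference
rules of regular logic. -/
inductive Entails (T : RegularTheory.{u, v}) :
    ∀ {Γ : List T.sig.Ty}, Formula T.sig Γ → Formula T.sig Γ → Prop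
  | ax {s : Sequent T.sig} (hs : s ∈ T.ax) : Entails T s.hyp s.concl
  | id {Γ : List T.sig.Ty} (φ : Formula T.sig Γ) : Entails T φ φ
  | cut {Γ : List T.sig.Ty} {φ χ ψ : Formula T.sig Γ} :
      Entails T φ χ → Entails T χ ψ → Entails T φ ψ
  | subst {Γ Δ : List T.sig.Ty} (t : Ren Γ Δ) {φ ψ : Formula T.sig Γ} :
      Entails T φ ψ → Entails T (φ.subst t) (ψ.subst t)
  | eq_refl {Γ : List T.sig.Ty} (φ : Formula T.sig Γ) {A : T.sig.Ty} (x : Var Γ A) :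
      Entails T φ (eq x x)
  /-- `(x⃗ = y⃗) ∧ φ[x⃗/z⃗] ⊢ φ[y⃗/z⃗]`, where `z⃗` are the variables of `φ`. -/
  | eq_subst {Γ Θ : List T.sig.Ty} (x y : Ren Θ Γ) (φ : Formula T.sig Θ) :
      Entails T (and (eqs x y) (φ.subst x)) (φ.subst y)
  | top_intro {Γ : List T.sig.Ty} (φ : Formula T.sig Γ) : Entails T φ top
  | and_intro {Γ : List T.sig.Ty} {φ ψ χ : Formula T.sig Γ} :
      Entails T φ ψ → Entails T φ χ → Entails T φ (and ψ χ)
  | and_left {Γ : List T.sig.Ty} (φ ψ : Formula T.sig Γ) : Entails T (and φ ψ) φ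
  | and_right {Γ : List T.sig.Ty} (φ ψ : Formula T.sig Γ) : Entails T (and φ ψ) ψ
  | ex_elim {Γ : List T.sig.Ty} {A : T.sig.Ty} {φ : Formula T.sig (A :: Γ)}
      {ψ : Formula T.sig Γ} : Entails T φ (ψ.subst (Ren.wk A)) → Entails T (ex A φ) ψ
  | ex_unit {Γ : List T.sig.Ty} {A : T.sig.Ty} {φ : Formula T.sig (A :: Γ)}
      {ψ : Formula T.sig Γ} : Entails T (ex A φ) ψ → Entails T φ (ψ.subst (Ren.wk A))
  | frobenius {Γ : List T.sig.Ty} {A : T.sig.Ty} (φ : Formula T.sig Γ)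
      (ψ : Formula T.sig (A :: Γ)) :
      Entails T (and φ (ex A ψ)) (ex A (and (φ.subst (Ren.wk A)) ψ))

/-! ### Substitution lemmas -/

namespace Ren

variable {T : Type u} {Γ Δ Θ Ξ : List T}

@[ext] theorem ext' {σ τ : Ren Γ Δ} (h : ∀ A (x : Var Γ A), σ x = τ x) : σ = τ := by
  funext A x; exact h A x

@[simp] theorem id_apply {A : T} (x : Var Γ A) : Ren.id Γ x = x := rfl

@[simp] theorem comp_apply (σ : Ren Γ Δ) (τ : Ren Δ Θ) {A : T} (x : Var Γ A) :
    σ.comp τ x = τ (σ x) := rfl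

@[simp] theorem tail_apply {A B : T} (σ : Ren (A :: Γ) Δ) (x : Var Γ B) :
    σ.tail x = σ x.succ := rfl

@[simp] theorem wk_apply {A B : T} (x : Var Γ B) : wk A x = x.succ := rfl

@[simp] theorem app_inl (σ : Ren Γ Ξ) (τ : Ren Δ Ξ) {A : T} (x : Var Γ A) :
    app σ τ (inl Δ x) = σ x := by
  induction x with
  | zero => rfl
  | succ x ih => exact ih (tail σ)

@[simp] theorem app_inr (σ : Ren Γ Ξ) (τ : Ren Δ Ξ) {A : T} (x : Var Δ A) :
    app σ τ (inr Γ x) = τ x := by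
  induction Γ with
  | nil => rfl
  | cons B Γ ih => exact ih (tail σ)

theorem app_cases {Γ Δ : List T} {P : ∀ A, Var (Γ ++ Δ) A → Prop}
    (hl : ∀ A (x : Var Γ A), P A (inl Δ x)) (hr : ∀ A (x : Var Δ A), P A (inr Γ x)) :
    ∀ A (x : Var (Γ ++ Δ) A), P A x := by
  induction Γ with
  | nil => exact hr
  | cons B Γ ih =>
    intro A x
    cases x with
    | zero => exact hl _ .zero
    | succ x => exact ih (P := fun A x => P A x.succ) (fun A x => hl A x.succ) hr A x

theorem app_ext {σ τ : Ren (Γ ++ Δ) Ξ} (hl : ∀ A (x : Var Γ A), σ (inl Δ x) = τ (inl Δ x))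
    (hr : ∀ A (x : Var Δ A), σ (inr Γ x) = τ (inr Γ x)) : σ = τ :=
  ext' (app_cases hl hr)

@[simp] theorem app_comp (σ : Ren Γ Δ) (τ : Ren Θ Δ) (ρ : Ren Δ Ξ) :
    (app σ τ).comp ρ = app (σ.comp ρ) (τ.comp ρ) :=
  app_ext (by simp) (by simp)

theorem inl_comp_app (σ : Ren Γ Ξ) (τ : Ren Δ Ξ) : (inl Δ).comp (app σ τ) = σ := by
  ext; simp

theorem inr_comp_app (σ : Ren Γ Ξ) (τ : Ren Δ Ξ) : (inr Γ).comp (app σ τ) = τ := by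
  ext; simp

theorem lift_comp (A : T) (σ : Ren Γ Δ) (τ : Ren Δ Θ) :
    (σ.comp τ).lift A = (σ.lift A).comp (τ.lift A) := by
  ext B x; cases x <;> rfl

theorem lift_id (A : T) : (Ren.id Γ).lift A = Ren.id (A :: Γ) := by
  ext B x; cases x <;> rfl

theorem wk_lift (A : T) (σ : Ren Γ Δ) : (wk A).comp (σ.lift A) = σ.comp (wk A) := rfl

/-- Extension of a substitution to several more (bound) variables. -/
def lifts (Θ : List T) (σ : Ren Γ Δ) : Ren (Θ ++ Γ) (Θ ++ Δ) := app (inl Δ) (σ.comp (inr Θ))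

theorem lifts_cons (A : T) (Θ : List T) (σ : Ren Γ Δ) :
    lifts (A :: Θ) σ = (lifts Θ σ).lift A := by
  ext B x
  cases x with
  | zero => rfl
  | succ x =>
    revert x
    refine app_cases (Γ := Θ) (Δ := Γ) (P := fun B x => lifts (A :: Θ) σ x.succ =
      lift A (lifts Θ σ) x.succ) (fun B x => ?_) (fun B x => ?_) B
    · change app (tail (inl Δ)) _ (inl Γ x) = Var.succ (app (inl Δ) _ (inl Γ x))
      rw [app_inl, app_inl]; rfl
    · change app (tail (inl Δ)) _ (inr Θ x) = Var.succ (app (inl Δ) _ (inr Θ x))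
      rw [app_inr, app_inr]; rfl

end Ren

namespace Formula

variable {S : Signature.{u, v}} {Γ Δ Θ Ξ : List S.Ty}

@[simp] theorem subst_subst (σ : Ren Γ Δ) (τ : Ren Δ Θ) (φ : Formula S Γ) :
    (φ.subst σ).subst τ = φ.subst (σ.comp τ) := by
  induction φ generalizing Δ Θ with
  | rel R x => rfl
  | eq x y => rfl
  | top => rfl
  | and φ ψ h1 h2 => simp [subst, h1, h2]
  | ex A φ ih => simp [subst, ih, Ren.lift_comp]

theorem subst_id (φ : Formula S Γ) : φ.subst (Ren.id Γ) = φ := by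
  induction φ with
  | rel R x => rfl
  | eq x y => rfl
  | top => rfl
  | and φ ψ h1 h2 => simp [subst, h1, h2]
  | ex A φ ih => simp [subst, ih, Ren.lift_id]

@[simp] theorem subst_and (σ : Ren Γ Δ) (φ ψ : Formula S Γ) :
    (and φ ψ).subst σ = and (φ.subst σ) (ψ.subst σ) := rfl

@[simp] theorem subst_eqs (ρ : Ren Γ Δ) (σ τ : Ren Θ Γ) :
    (eqs (S := S) σ τ).subst ρ = eqs (σ.comp ρ) (τ.comp ρ) := by
  induction Θ with
  | nil => rfl
  | cons A Θ ih => simp only [eqs, subst, ih]; rfl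

theorem subst_exs (ρ : Ren Γ Δ) (φ : Formula S (Θ ++ Γ)) :
    (exs φ).subst ρ = exs (φ.subst (ρ.lifts Θ)) := by
  induction Θ with
  | nil => rfl
  | cons A Θ ih =>
    have := ih (ex A φ)
    simp only [exs, this, Ren.lifts_cons]; rfl

end Formula

/-! ### Derived rules -/

namespace Entails

open Formula

variable {T : RegularTheory.{u, v}} {Γ Δ Θ Ξ : List T.sig.Ty}

theorem symm_eq {χ : Formula T.sig Γ} {A} {x y : Var Γ A} (h : Entails T χ (eq x y)) :
    Entails T χ (eq y x) := by
  have := eq_subst (T := T) (Θ := [A, A]) (Γ := Γ) (Ren.cons x (Ren.cons x Ren.nil)) (Ren.cons y (Ren.cons x Ren.nil))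
    (eq .zero (.succ .zero))
  refine cut (and_intro (and_intro h (and_intro (eq_refl _ _) (top_intro _))) ?_) this
  exact eq_refl _ _

theorem trans_eq {χ : Formula T.sig Γ} {A} {x y z : Var Γ A} (h : Entails T χ (eq x y))
    (h' : Entails T χ (eq y z)) : Entails T χ (eq x z) := by
  have := eq_subst (T := T) (Θ := [A, A]) (Γ := Γ) (Ren.cons x (Ren.cons y Ren.nil)) (Ren.cons x (Ren.cons z Ren.nil))
    (eq .zero (.succ .zero))
  exact cut (and_intro (and_intro (eq_refl _ _) (and_intro h' (top_intro _))) h) this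

theorem eqs_intro {χ : Formula T.sig Γ} {x y : Ren Θ Γ}
    (h : ∀ A (z : Var Θ A), Entails T χ (eq (x z) (y z))) : Entails T χ (eqs x y) := by
  induction Θ with
  | nil => exact top_intro _
  | cons A Θ ih => exact and_intro (h _ .zero) (ih fun B z => h B z.succ)

theorem eqs_elim {χ : Formula T.sig Γ} {x y : Ren Θ Γ} (h : Entails T χ (eqs x y)) {A}
    (z : Var Θ A) : Entails T χ (eq (x z) (y z)) := by
  induction z with
  | zero => exact h.cut (and_left _ _)
  | succ z ih => exact ih (x := x.tail) (y := y.tail) (h.cut (and_right _ _))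

theorem left {χ φ ψ : Formula T.sig Γ} (h : Entails T χ (and φ ψ)) : Entails T χ φ :=
  h.cut (and_left _ _)

theorem right {χ φ ψ : Formula T.sig Γ} (h : Entails T χ (and φ ψ)) : Entails T χ ψ :=
  h.cut (and_right _ _)

/-- Replacing variables of a formula by provably equal ones. -/
theorem congr {χ : Formula T.sig Γ} {φ : Formula T.sig Θ} {x y : Ren Θ Γ}
    (h : Entails T χ (φ.subst x)) (e : ∀ A (z : Var Θ A), Entails T χ (eq (x z) (y z))) :
    Entails T χ (φ.subst y) :=
  cut (and_intro (eqs_intro e) h) (eq_subst x y φ)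

theorem exs_adj {φ : Formula T.sig (Θ ++ Γ)} {ψ : Formula T.sig Γ} :
    Entails T (exs φ) ψ ↔ Entails T φ (ψ.subst (Ren.inr Θ)) := by
  induction Θ with
  | nil => rw [show ψ.subst (Ren.inr []) = ψ from subst_id ψ]; rfl
  | cons A Θ ih =>
    refine (ih (φ := ex A φ)).trans ?_
    have : ψ.subst (Ren.inr (A :: Θ)) = (ψ.subst (Ren.inr Θ)).subst (Ren.wk A) := by
      rw [subst_subst]; rfl
    rw [this]
    exact ⟨ex_unit, ex_elim⟩

theorem exs_frobenius {χ ψ : Formula T.sig Γ} {φ : Formula T.sig (Θ ++ Γ)}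
    (h : Entails T (and (χ.subst (Ren.inr Θ)) φ) (ψ.subst (Ren.inr Θ))) :
    Entails T (and χ (exs φ)) ψ := by
  induction Θ with
  | nil =>
    rw [show χ.subst (Ren.inr []) = χ from subst_id χ,
      show ψ.subst (Ren.inr []) = ψ from subst_id ψ] at h
    exact h
  | cons A Θ ih =>
    refine ih (φ := ex A φ) ((frobenius _ _).cut (ex_elim ?_))
    rw [subst_subst, subst_subst]
    exact h

/-- Introduction of several existential quantifiers. -/
theorem exs_intro {χ : Formula T.sig Γ} {φ : Formula T.sig (Θ ++ Γ)} (t : Ren Θ Γ)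
    (h : Entails T χ (φ.subst (Ren.app t (Ren.id Γ)))) : Entails T χ (exs φ) := by
  refine h.cut ?_
  have := (exs_adj.1 (Entails.id (T := T) (exs φ))).subst (Ren.app t (Ren.id Γ))
  rw [subst_subst] at this
  rwa [show (Ren.inr Θ).comp (Ren.app t (Ren.id Γ)) = Ren.id Γ by ext; simp, subst_id] at this

/-- Elimination of several existential quantifiers. -/
theorem exs_elim {χ ψ : Formula T.sig Γ} {φ : Formula T.sig (Θ ++ Γ)} (h : Entails T χ (exs φ))
    (h' : Entails T (and (χ.subst (Ren.inr Θ)) φ) (ψ.subst (Ren.inr Θ))) : Entails T χ ψ :=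
  cut (and_intro (Entails.id χ) h) (exs_frobenius h')

end Entails

/-! ### The classifying category of a regular theory -/

/-- The objects of the classifying category of `T`: finite lists of basic types. -/
@[ext] structure Cl (T : RegularTheory.{u, v}) : Type u where
  ctx : List T.sig.Ty

/-- Provable equivalence of formulas in context. -/
def provEquiv (T : RegularTheory.{u, v}) (Γ : List T.sig.Ty) : Setoid (Formula T.sig Γ) where
  r φ ψ := Entails T φ ψ ∧ Entails T ψ φ
  iseqv := ⟨fun φ => ⟨.id φ, .id φ⟩, fun h => ⟨h.2, h.1⟩,
    fun h h' => ⟨h.1.cut h'.1, h'.2.cut h.2⟩⟩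

namespace Cl

open Formula

variable {T : RegularTheory.{u, v}}

/-- Morphisms `Γ ⟶ Γ'` of the classifying category: classes `[Γ; Γ' ∣ φ]` of formulas in the
context `Γ, Γ'` up to provable equivalence. -/
def Hom (Γ Γ' : Cl T) : Type (max u v) :=
  Quotient (provEquiv T (Γ.ctx ++ Γ'.ctx))

/-- The morphism `[Γ; Γ' ∣ φ]`. -/
def Hom.mk (Γ Γ' : List T.sig.Ty) (φ : Formula T.sig (Γ ++ Γ')) : Hom (T := T) ⟨Γ⟩ ⟨Γ'⟩ :=
  Quotient.mk (provEquiv T (Γ ++ Γ')) φ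

/-- The 2-morphisms of the classifying category: `[Γ; Γ' ∣ φ] ≤ [Γ; Γ' ∣ ψ]` if and only if
`Γ, Γ' ∣ φ ⊢ ψ`. -/
instance (Γ Γ' : Cl T) : PartialOrder (Hom Γ Γ') where
  le := Quotient.lift₂ (fun φ ψ => Entails T φ ψ) fun _ _ _ _ h h' =>
    propext ⟨fun k => (h.2.cut k).cut h'.1, fun k => (h.1.cut k).cut h'.2⟩
  le_refl := by rintro ⟨φ⟩; exact .id φ
  le_trans := by rintro ⟨φ⟩ ⟨ψ⟩ ⟨χ⟩ h h'; exact Entails.cut h h'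
  le_antisymm := by rintro ⟨φ⟩ ⟨ψ⟩ h h'; exact Quotient.sound ⟨h, h'⟩

theorem mk_le_mk {Γ Γ' : List T.sig.Ty} {φ ψ : Formula T.sig (Γ ++ Γ')} :
    Hom.mk Γ Γ' φ ≤ Hom.mk Γ Γ' ψ ↔ Entails T φ ψ := Iff.rfl

section Operations

variable {A B C D : List T.sig.Ty}

/-- The formula `∃ y⃗ : B. φ(x⃗, y⃗) ∧ ψ(y⃗, z⃗)` in the context `x⃗ : A, z⃗ : C`. -/
def compF (φ : Formula T.sig (A ++ B)) (ψ : Formula T.sig (B ++ C)) : Formula T.sig (A ++ C) :=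
  exs (Θ := B) <| and
    (φ.subst (Ren.app ((Ren.inl C).comp (Ren.inr B)) (Ren.inl (A ++ C))))
    (ψ.subst (Ren.app (Ren.inl (A ++ C)) ((Ren.inr A).comp (Ren.inr B))))

/-- The formula `φ(x⃗, y⃗) ∧ ψ(z⃗, w⃗)` in the context `x⃗ : A, z⃗ : C, y⃗ : B, w⃗ : D`. -/
def tensorF (φ : Formula T.sig (A ++ B)) (ψ : Formula T.sig (C ++ D)) :
    Formula T.sig ((A ++ C) ++ (B ++ D)) :=
  and
    (φ.subst (Ren.app ((Ren.inl C).comp (Ren.inl (B ++ D)))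
      ((Ren.inl D).comp (Ren.inr (A ++ C)))))
    (ψ.subst (Ren.app ((Ren.inr A).comp (Ren.inl (B ++ D)))
      ((Ren.inr B).comp (Ren.inr (A ++ C)))))

/-- The formula `f(x⃗) = y⃗`, i.e. `x_{f 1} = y₁ ∧ ⋯ ∧ x_{f n} = yₙ`, in the context
`x⃗ : A, y⃗ : B`. -/
def graphF (f : Ren B A) : Formula T.sig (A ++ B) := eqs (f.comp (Ren.inl B)) (Ren.inr A)

/-- The formula `x⃗ = g(y⃗)`, i.e. `x₁ = y_{g 1} ∧ ⋯ ∧ xₙ = y_{g n}`, in the context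
`x⃗ : A, y⃗ : B`. -/
def cographF (g : Ren A B) : Formula T.sig (A ++ B) := eqs (Ren.inl B) (g.comp (Ren.inr A))

end Operations

/-! The validity of a formula for given arguments under a hypothesis. -/

section Holds

variable {A B C D Ξ : List T.sig.Ty}

/-- `φ(a⃗, b⃗)` is a consequence of `χ`. -/
def HoldsF (χ : Formula T.sig Ξ) (φ : Formula T.sig (A ++ B)) (a : Ren A Ξ) (b : Ren B Ξ) : Prop :=
  Entails T χ (φ.subst (Ren.app a b))

theorem HoldsF.map {Ξ' : List T.sig.Ty} {χ : Formula T.sig Ξ} {φ : Formula T.sig (A ++ B)}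
    {a : Ren A Ξ} {b : Ren B Ξ} (h : HoldsF χ φ a b) (ρ : Ren Ξ Ξ') {χ' : Formula T.sig Ξ'}
    (h' : Entails T χ' (χ.subst ρ)) : HoldsF χ' φ (a.comp ρ) (b.comp ρ) := by
  have := h'.cut (Entails.subst ρ h)
  rwa [subst_subst, Ren.app_comp] at this

theorem HoldsF.congr {χ : Formula T.sig Ξ} {φ : Formula T.sig (A ++ B)}
    {a a' : Ren A Ξ} {b b' : Ren B Ξ} (h : HoldsF χ φ a b)
    (ha : ∀ S (z : Var A S), Entails T χ (eq (a z) (a' z)))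
    (hb : ∀ S (z : Var B S), Entails T χ (eq (b z) (b' z))) : HoldsF χ φ a' b' :=
  Entails.congr h (Ren.app_cases (by simpa using ha) (by simpa using hb))

theorem holdsF_self (φ : Formula T.sig (A ++ B)) : HoldsF φ φ (Ren.inl B) (Ren.inr A) := by
  have : Ren.app (Ren.inl B) (Ren.inr A) = Ren.id (A ++ B) := Ren.app_ext (by simp) (by simp)
  rw [HoldsF, this, subst_id]
  exact .id φ

theorem holdsF_eqs {Θ : List T.sig.Ty} {χ : Formula T.sig Ξ} {s t : Ren Θ (A ++ B)} {a : Ren A Ξ}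
    {b : Ren B Ξ} : HoldsF χ (eqs s t) a b ↔
      ∀ S (z : Var Θ S), Entails T χ (eq (Ren.app a b (s z)) (Ren.app a b (t z))) := by
  rw [HoldsF, subst_eqs]
  exact ⟨fun h S z => Entails.eqs_elim h z, fun h => Entails.eqs_intro h⟩

theorem holdsF_graphF {χ : Formula T.sig Ξ} {f : Ren B A} {a : Ren A Ξ} {b : Ren B Ξ} :
    HoldsF χ (graphF f) a b ↔ ∀ S (z : Var B S), Entails T χ (eq (a (f z)) (b z)) := by
  simp [graphF, holdsF_eqs]

theorem holdsF_cographF {χ : Formula T.sig Ξ} {g : Ren A B} {a : Ren A Ξ} {b : Ren B Ξ} :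
    HoldsF χ (cographF g) a b ↔ ∀ S (z : Var A S), Entails T χ (eq (a z) (b (g z))) := by
  simp [cographF, holdsF_eqs]

theorem holdsF_tensorF {χ : Formula T.sig Ξ} {φ : Formula T.sig (A ++ B)}
    {ψ : Formula T.sig (C ++ D)} {a : Ren (A ++ C) Ξ} {b : Ren (B ++ D) Ξ} :
    HoldsF χ (tensorF φ ψ) a b ↔
      HoldsF χ φ ((Ren.inl C).comp a) ((Ren.inl D).comp b) ∧
      HoldsF χ ψ ((Ren.inr A).comp a) ((Ren.inr B).comp b) := by
  have e1 : Ren.app (((Ren.inl C).comp (Ren.inl (B ++ D))).comp (Ren.app a b))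
      (((Ren.inl D).comp (Ren.inr (A ++ C))).comp (Ren.app a b)) =
      Ren.app ((Ren.inl C).comp a) ((Ren.inl D).comp b) := Ren.app_ext (by simp) (by simp)
  have e2 : Ren.app (((Ren.inr A).comp (Ren.inl (B ++ D))).comp (Ren.app a b))
      (((Ren.inr B).comp (Ren.inr (A ++ C))).comp (Ren.app a b)) =
      Ren.app ((Ren.inr A).comp a) ((Ren.inr B).comp b) := Ren.app_ext (by simp) (by simp)
  simp only [HoldsF, tensorF, subst_and, subst_subst, Ren.app_comp, e1, e2]
  exact ⟨fun h => ⟨h.left, h.right⟩, fun h => .and_intro h.1 h.2⟩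

theorem holdsF_compF_intro {χ : Formula T.sig Ξ} {φ : Formula T.sig (A ++ B)}
    {ψ : Formula T.sig (B ++ C)} {a : Ren A Ξ} (b : Ren B Ξ) {c : Ren C Ξ}
    (h : HoldsF χ φ a b) (h' : HoldsF χ ψ b c) : HoldsF χ (compF φ ψ) a c := by
  rw [HoldsF, compF, subst_exs]
  refine Entails.exs_intro b ?_
  simp only [subst_and, subst_subst, Ren.app_comp]
  have e1 : Ren.app ((((Ren.inl C).comp (Ren.inr B)).comp ((Ren.app a c).lifts B)).comp
      (Ren.app b (Ren.id Ξ))) (((Ren.inl (A ++ C)).comp ((Ren.app a c).lifts B)).comp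
      (Ren.app b (Ren.id Ξ))) = Ren.app a b :=
    Ren.app_ext (by simp [Ren.lifts]) (by simp [Ren.lifts])
  have e2 : Ren.app (((Ren.inl (A ++ C)).comp ((Ren.app a c).lifts B)).comp
      (Ren.app b (Ren.id Ξ))) ((((Ren.inr A).comp (Ren.inr B)).comp ((Ren.app a c).lifts B)).comp
      (Ren.app b (Ren.id Ξ))) = Ren.app b c :=
    Ren.app_ext (by simp [Ren.lifts]) (by simp [Ren.lifts])
  rw [e1, e2]
  exact .and_intro h h'

theorem holdsF_compF_elim {χ θ : Formula T.sig Ξ} {φ : Formula T.sig (A ++ B)}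
    {ψ : Formula T.sig (B ++ C)} {a : Ren A Ξ} {c : Ren C Ξ} (h : HoldsF χ (compF φ ψ) a c)
    (k : ∀ (Ξ' : List T.sig.Ty) (ρ : Ren Ξ Ξ') (b : Ren B Ξ') (χ' : Formula T.sig Ξ'),
      Entails T χ' (χ.subst ρ) → HoldsF χ' φ (a.comp ρ) b → HoldsF χ' ψ b (c.comp ρ) →
      Entails T χ' (θ.subst ρ)) : Entails T χ θ := by
  rw [HoldsF, compF, subst_exs] at h
  refine Entails.exs_elim h (k _ (Ren.inr B) (Ren.inl Ξ) _ (.and_left _ _) ?_ ?_)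
  · refine (Entails.and_right _ _).cut ((Entails.and_left _ _).cut ?_)
    rw [subst_subst, Ren.app_comp]
    have e1 : Ren.app (((Ren.inl C).comp (Ren.inr B)).comp ((Ren.app a c).lifts B))
        ((Ren.inl (A ++ C)).comp ((Ren.app a c).lifts B)) =
        Ren.app (a.comp (Ren.inr B)) (Ren.inl Ξ) :=
      Ren.app_ext (by simp [Ren.lifts]) (by simp [Ren.lifts])
    rw [e1]
    exact .id _
  · refine (Entails.and_right _ _).cut ((Entails.and_right _ _).cut ?_)
    rw [subst_subst, Ren.app_comp]
    have e1 : Ren.app ((Ren.inl (A ++ C)).comp ((Ren.app a c).lifts B))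
        (((Ren.inr A).comp (Ren.inr B)).comp ((Ren.app a c).lifts B)) =
        Ren.app (Ren.inl Ξ) (c.comp (Ren.inr B)) :=
      Ren.app_ext (by simp [Ren.lifts]) (by simp [Ren.lifts])
    rw [e1]
    exact .id _

theorem entails_iff_holdsF {φ ψ : Formula T.sig (A ++ B)} :
    Entails T φ ψ ↔ ∀ (Ξ : List T.sig.Ty) (χ : Formula T.sig Ξ) (a : Ren A Ξ) (b : Ren B Ξ),
      HoldsF χ φ a b → HoldsF χ ψ a b := by
  refine ⟨fun h Ξ χ a b k => Entails.cut k (h.subst _), fun h => ?_⟩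
  have := h _ φ _ _ (holdsF_self φ)
  rwa [HoldsF, show Ren.app (Ren.inl B) (Ren.inr A) = Ren.id (A ++ B) from
    Ren.app_ext (by simp) (by simp), subst_id] at this

theorem compF_mono {φ φ' : Formula T.sig (A ++ B)} {ψ ψ' : Formula T.sig (B ++ C)}
    (h : Entails T φ φ') (h' : Entails T ψ ψ') : Entails T (compF φ ψ) (compF φ' ψ') := by
  rw [entails_iff_holdsF] at *
  intro Ξ χ a c k
  refine holdsF_compF_elim k fun Ξ' ρ b χ' hχ h1 h2 => ?_
  rw [subst_subst, Ren.app_comp]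
  exact holdsF_compF_intro b (h _ _ _ _ h1) (h' _ _ _ _ h2)

theorem tensorF_mono {φ φ' : Formula T.sig (A ++ B)} {ψ ψ' : Formula T.sig (C ++ D)}
    (h : Entails T φ φ') (h' : Entails T ψ ψ') : Entails T (tensorF φ ψ) (tensorF φ' ψ') := by
  rw [entails_iff_holdsF] at *
  intro Ξ χ a c k
  rw [holdsF_tensorF] at *
  exact ⟨h _ _ _ _ k.1, h' _ _ _ _ k.2⟩

end Holds

/-- Identity morphisms and composition of the classifying category:
`𝟙 = [x⃗ : A; x⃗' : A ∣ x⃗ = x⃗']` and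
`[x⃗ : A; y⃗ : B ∣ φ] ≫ [y⃗ : B; z⃗ : C ∣ ψ] = [x⃗ : A; z⃗ : C ∣ ∃ y⃗ : B. φ ∧ ψ]`. -/
instance : CategoryStruct (Cl T) where
  Hom := Hom
  id A := Hom.mk A.ctx A.ctx (graphF (Ren.id A.ctx))
  comp {A B C} := Quotient.map₂ (compF (A := A.ctx) (B := B.ctx) (C := C.ctx))
    fun _ _ h _ _ h' => ⟨compF_mono h.1 h'.1, compF_mono h.2 h'.2⟩

/-- The hom-sets of the classifying category are ordered by entailment. -/
instance homOrder (A B : Cl T) : PartialOrder (A ⟶ B) :=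
  inferInstanceAs (PartialOrder (Hom A B))

/-- The monoidal product on morphisms:
`[Γ; Δ ∣ φ] ⊗ [Γ'; Δ' ∣ ψ] = [Γ, Γ'; Δ, Δ' ∣ φ ∧ ψ]`. -/
def tensor {A B C D : List T.sig.Ty} :
    Hom (T := T) ⟨A⟩ ⟨B⟩ → Hom (T := T) ⟨C⟩ ⟨D⟩ → Hom (T := T) ⟨A ++ C⟩ ⟨B ++ D⟩ :=
  Quotient.map₂ (tensorF (A := A) (B := B) (C := C) (D := D))
    fun _ _ h _ _ h' => ⟨tensorF_mono h.1 h'.1, tensorF_mono h.2 h'.2⟩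

/-- The morphism `[x⃗ : A; y⃗ : B ∣ f(x⃗) = y⃗]`, for a tuple `f` of variables of `x⃗ : A`. -/
def graph {A B : List T.sig.Ty} (f : Ren B A) : Quiver.Hom (V := Cl T) ⟨A⟩ ⟨B⟩ := Hom.mk A B (graphF f)

/-- The morphism `[x⃗ : A; y⃗ : B ∣ x⃗ = g(y⃗)]`, for a tuple `g` of variables of `y⃗ : B`. -/
def cograph {A B : List T.sig.Ty} (g : Ren A B) : Quiver.Hom (V := Cl T) ⟨A⟩ ⟨B⟩ :=
  Hom.mk A B (cographF g)

section Laws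

variable {A B C D E Ξ : List T.sig.Ty}

/-- `HoldsF` for morphisms of the classifying category. -/
def Holds (χ : Formula T.sig Ξ) (R : Quiver.Hom (V := Cl T) ⟨A⟩ ⟨B⟩) (a : Ren A Ξ) (b : Ren B Ξ) :
    Prop :=
  Quotient.liftOn R (fun φ => HoldsF χ φ a b) fun _ _ h => propext
    ⟨entails_iff_holdsF.1 h.1 _ _ _ _, entails_iff_holdsF.1 h.2 _ _ _ _⟩

theorem le_iff {R S : Quiver.Hom (V := Cl T) ⟨A⟩ ⟨B⟩} :
    R ≤ S ↔ ∀ (Ξ : List T.sig.Ty) (χ : Formula T.sig Ξ) (a : Ren A Ξ) (b : Ren B Ξ),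
      Holds χ R a b → Holds χ S a b := by
  induction R using Quotient.ind
  induction S using Quotient.ind
  exact entails_iff_holdsF

theorem hom_ext {R S : Quiver.Hom (V := Cl T) ⟨A⟩ ⟨B⟩}
    (h : ∀ (Ξ : List T.sig.Ty) (χ : Formula T.sig Ξ) (a : Ren A Ξ) (b : Ren B Ξ),
      Holds χ R a b ↔ Holds χ S a b) : R = S :=
  le_antisymm (le_iff.2 fun Ξ χ a b => (h Ξ χ a b).1) (le_iff.2 fun Ξ χ a b => (h Ξ χ a b).2)

theorem Holds.map {Ξ' : List T.sig.Ty} {χ : Formula T.sig Ξ} {R : Quiver.Hom (V := Cl T) ⟨A⟩ ⟨B⟩}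
    {a : Ren A Ξ} {b : Ren B Ξ} (h : Holds χ R a b) (ρ : Ren Ξ Ξ') {χ' : Formula T.sig Ξ'}
    (h' : Entails T χ' (χ.subst ρ)) : Holds χ' R (a.comp ρ) (b.comp ρ) := by
  induction R using Quotient.ind
  exact HoldsF.map h ρ h'

theorem Holds.congr {χ : Formula T.sig Ξ} {R : Quiver.Hom (V := Cl T) ⟨A⟩ ⟨B⟩}
    {a a' : Ren A Ξ} {b b' : Ren B Ξ} (h : Holds χ R a b)
    (ha : ∀ S (z : Var A S), Entails T χ (eq (a z) (a' z)))
    (hb : ∀ S (z : Var B S), Entails T χ (eq (b z) (b' z))) : Holds χ R a' b' := by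
  induction R using Quotient.ind
  exact HoldsF.congr h ha hb

theorem holds_graph {χ : Formula T.sig Ξ} {f : Ren B A} {a : Ren A Ξ} {b : Ren B Ξ} :
    Holds χ (graph f) a b ↔ ∀ S (z : Var B S), Entails T χ (eq (a (f z)) (b z)) :=
  holdsF_graphF

theorem holds_cograph {χ : Formula T.sig Ξ} {g : Ren A B} {a : Ren A Ξ} {b : Ren B Ξ} :
    Holds χ (cograph g) a b ↔ ∀ S (z : Var A S), Entails T χ (eq (a z) (b (g z))) :=
  holdsF_cographF

theorem holds_tensor {χ : Formula T.sig Ξ} {R : Quiver.Hom (V := Cl T) ⟨A⟩ ⟨B⟩}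
    {S : Quiver.Hom (V := Cl T) ⟨C⟩ ⟨D⟩} {a : Ren (A ++ C) Ξ} {b : Ren (B ++ D) Ξ} :
    Holds (A := A ++ C) (B := B ++ D) χ (tensor R S) a b ↔
      Holds χ R ((Ren.inl C).comp a) ((Ren.inl D).comp b) ∧
      Holds χ S ((Ren.inr A).comp a) ((Ren.inr B).comp b) := by
  induction R using Quotient.ind
  induction S using Quotient.ind
  exact holdsF_tensorF

theorem holds_comp_intro {χ : Formula T.sig Ξ} {R : Quiver.Hom (V := Cl T) ⟨A⟩ ⟨B⟩}
    {S : Quiver.Hom (V := Cl T) ⟨B⟩ ⟨C⟩} {a : Ren A Ξ} (b : Ren B Ξ) {c : Ren C Ξ}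
    (h : Holds χ R a b) (h' : Holds χ S b c) : Holds χ (CategoryStruct.comp R S) a c := by
  induction R using Quotient.ind
  induction S using Quotient.ind
  exact holdsF_compF_intro b h h'

theorem holds_comp_elim {χ : Formula T.sig Ξ} {R : Quiver.Hom (V := Cl T) ⟨A⟩ ⟨B⟩}
    {S : Quiver.Hom (V := Cl T) ⟨B⟩ ⟨C⟩} {a : Ren A Ξ} {c : Ren C Ξ}
    (h : Holds χ (CategoryStruct.comp R S) a c)
    {Q : Quiver.Hom (V := Cl T) ⟨D⟩ ⟨E⟩} {d : Ren D Ξ} {e : Ren E Ξ}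
    (k : ∀ (Ξ' : List T.sig.Ty) (ρ : Ren Ξ Ξ') (b : Ren B Ξ') (χ' : Formula T.sig Ξ'),
      Entails T χ' (χ.subst ρ) → Holds χ' R (a.comp ρ) b → Holds χ' S b (c.comp ρ) →
      Holds χ' Q (d.comp ρ) (e.comp ρ)) : Holds χ Q d e := by
  induction R using Quotient.ind
  induction S using Quotient.ind
  induction Q using Quotient.ind
  refine holdsF_compF_elim h fun Ξ' ρ b χ' h1 h2 h3 => ?_
  rw [subst_subst, Ren.app_comp]
  exact k Ξ' ρ b χ' h1 h2 h3

theorem holds_graph_comp {χ : Formula T.sig Ξ} {f : Ren B A} {S : Quiver.Hom (V := Cl T) ⟨B⟩ ⟨C⟩}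
    {a : Ren A Ξ} {c : Ren C Ξ} :
    Holds χ (CategoryStruct.comp (graph f) S) a c ↔ Holds χ S (f.comp a) c := by
  refine ⟨fun h => holds_comp_elim h fun Ξ' ρ b χ' h1 h2 h3 => ?_, fun h =>
    holds_comp_intro (f.comp a) (holds_graph.2 fun _ _ => .eq_refl _ _) h⟩
  exact h3.congr (fun _ z => (holds_graph.1 h2 _ z).symm_eq) fun _ _ => .eq_refl _ _

theorem holds_comp_cograph {χ : Formula T.sig Ξ} {g : Ren B C} {R : Quiver.Hom (V := Cl T) ⟨A⟩ ⟨B⟩}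
    {a : Ren A Ξ} {c : Ren C Ξ} :
    Holds χ (CategoryStruct.comp R (cograph g)) a c ↔ Holds χ R a (g.comp c) := by
  refine ⟨fun h => holds_comp_elim h fun Ξ' ρ b χ' h1 h2 h3 => ?_, fun h =>
    holds_comp_intro (g.comp c) h (holds_cograph.2 fun _ _ => .eq_refl _ _)⟩
  exact h2.congr (fun _ _ => .eq_refl _ _) fun _ z => holds_cograph.1 h3 _ z

/-- The graph of a bijection of variables is the cograph of its inverse. -/
theorem graph_eq_cograph {f : Ren B A} {g : Ren A B} (h : f.comp g = Ren.id B)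
    (h' : g.comp f = Ren.id A) : graph (T := T) f = cograph g := by
  have h1 : ∀ S (z : Var B S), g (f z) = z := fun S z => congrFun (congrFun h S) z
  have h2 : ∀ S (z : Var A S), f (g z) = z := fun S z => congrFun (congrFun h' S) z
  refine hom_ext fun Ξ χ a b => ?_
  rw [holds_graph, holds_cograph]
  refine ⟨fun k S z => ?_, fun k S z => ?_⟩
  · simpa [h2] using k S (g z)
  · simpa [h1] using k S (f z)

theorem graph_comp (f : Ren B A) (g : Ren C B) :
    CategoryStruct.comp (graph (T := T) f) (graph g) = graph (g.comp f) :=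
  hom_ext fun Ξ χ a b => by rw [holds_graph_comp, holds_graph, holds_graph]; rfl

theorem graph_tensor (f : Ren B A) (g : Ren D C) :
    tensor (graph (T := T) f) (graph g) =
      graph (A := A ++ C) (B := B ++ D)
        (Ren.app (f.comp (Ren.inl C)) (g.comp (Ren.inr A))) := by
  refine hom_ext (A := A ++ C) (B := B ++ D) fun Ξ χ a b => ?_
  rw [holds_tensor, holds_graph, holds_graph, holds_graph]
  refine ⟨fun h => Ren.app_cases (by simpa using h.1) (by simpa using h.2), fun h => ⟨?_, ?_⟩⟩
  · intro S z; simpa using h S (Ren.inl D z)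
  · intro S z; simpa using h S (Ren.inr B z)

theorem cograph_tensor (f : Ren A B) (g : Ren C D) :
    tensor (cograph (T := T) f) (cograph g) =
      cograph (A := A ++ C) (B := B ++ D)
        (Ren.app (f.comp (Ren.inl D)) (g.comp (Ren.inr B))) := by
  refine hom_ext (A := A ++ C) (B := B ++ D) fun Ξ χ a b => ?_
  rw [holds_tensor, holds_cograph, holds_cograph, holds_cograph]
  refine ⟨fun h => Ren.app_cases (by simpa using h.1) (by simpa using h.2), fun h => ⟨?_, ?_⟩⟩
  · intro S z; simpa using h S (Ren.inl C z)
  · intro S z; simpa using h S (Ren.inr A z)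

end Laws

instance : Category (Cl T) where
  id_comp {A B} R := hom_ext fun Ξ χ a b => holds_graph_comp (f := Ren.id A.ctx)
  comp_id {A B} R := hom_ext fun Ξ χ a b => holds_comp_cograph (g := Ren.id B.ctx)
  assoc {A B C D} R S Q := by
    refine hom_ext fun Ξ χ a d => ⟨fun h => ?_, fun h => ?_⟩
    · refine holds_comp_elim h fun Ξ₁ ρ₁ c χ₁ hχ₁ h₁ h₂ => ?_
      refine holds_comp_elim h₁ fun Ξ₂ ρ₂ b χ₂ hχ₂ h₃ h₄ => ?_
      exact holds_comp_intro b h₃ (holds_comp_intro _ h₄ (h₂.map ρ₂ hχ₂))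
    · refine holds_comp_elim h fun Ξ₁ ρ₁ b χ₁ hχ₁ h₁ h₂ => ?_
      refine holds_comp_elim h₂ fun Ξ₂ ρ₂ c χ₂ hχ₂ h₃ h₄ => ?_
      exact holds_comp_intro c (holds_comp_intro _ (h₁.map ρ₂ hχ₂) h₃) h₄

/-- A bijection of variables gives an isomorphism of the classifying category. -/
def graphIso {A B : List T.sig.Ty} (f : Ren B A) (g : Ren A B) (h : f.comp g = Ren.id B)
    (h' : g.comp f = Ren.id A) : Iso (C := Cl T) ⟨A⟩ ⟨B⟩ where
  hom := graph f
  inv := graph g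
  hom_inv_id := by rw [graph_comp, h']; rfl
  inv_hom_id := by rw [graph_comp, h]; rfl

/-- The monoidal structure of the classifying category: concatenation of contexts, with the empty
context as unit.  The associators and unitors are the evident bijections of variables. -/
instance : MonoidalCategoryStruct (Cl T) where
  tensorObj A B := ⟨A.ctx ++ B.ctx⟩
  tensorUnit := ⟨[]⟩
  tensorHom R S := tensor R S
  whiskerLeft X _ _ R := tensor (𝟙 X) R
  whiskerRight R X := tensor R (𝟙 X)
  associator A B C := graphIso (A := (A.ctx ++ B.ctx) ++ C.ctx) (B := A.ctx ++ (B.ctx ++ C.ctx))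
    (Ren.app ((Ren.inl B.ctx).comp (Ren.inl C.ctx))
      (Ren.app ((Ren.inr A.ctx).comp (Ren.inl C.ctx)) (Ren.inr (A.ctx ++ B.ctx))))
    (Ren.app (Ren.app (Ren.inl (B.ctx ++ C.ctx)) ((Ren.inl C.ctx).comp (Ren.inr A.ctx)))
      ((Ren.inr B.ctx).comp (Ren.inr A.ctx)))
    (Ren.ext' <| Ren.app_cases (by simp) (Ren.app_cases (by simp) (by simp)))
    (Ren.ext' <| Ren.app_cases (Ren.app_cases (by simp) (by simp)) (by simp))
  leftUnitor A := graphIso (A := [] ++ A.ctx) (B := A.ctx) (Ren.inr []) (Ren.app Ren.nil (Ren.id A.ctx))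
    (by ext; simp) (Ren.app_ext (fun _ z => nomatch z) (by simp))
  rightUnitor A := graphIso (A := A.ctx ++ []) (B := A.ctx) (Ren.inl []) (Ren.app (Ren.id A.ctx) Ren.nil)
    (by ext; simp) (Ren.app_ext (by simp) (fun _ z => nomatch z))

theorem tensor_ctx (A B : Cl T) : (A ⊗ B).ctx = A.ctx ++ B.ctx := rfl

theorem unit_ctx : (𝟙_ (Cl T)).ctx = [] := rfl

theorem id_eq_graph (A : Cl T) : 𝟙 A = graph (Ren.id A.ctx) := rfl

theorem tensorHom_eq {A B C D : Cl T} (R : A ⟶ B) (S : C ⟶ D) : R ⊗ₘ S = tensor R S := rfl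

theorem whiskerLeft_eq (A : Cl T) {B C : Cl T} (R : B ⟶ C) : A ◁ R = tensor (𝟙 A) R := rfl

theorem whiskerRight_eq (A : Cl T) {B C : Cl T} (R : B ⟶ C) : R ▷ A = tensor R (𝟙 A) := rfl

theorem associator_hom_eq (A B C : Cl T) : (α_ A B C).hom =
    graph (A := (A.ctx ++ B.ctx) ++ C.ctx) (B := A.ctx ++ (B.ctx ++ C.ctx))
    (Ren.app ((Ren.inl B.ctx).comp (Ren.inl C.ctx))
      (Ren.app ((Ren.inr A.ctx).comp (Ren.inl C.ctx)) (Ren.inr (A.ctx ++ B.ctx)))) := rfl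

theorem associator_inv_eq (A B C : Cl T) : (α_ A B C).inv =
    graph (A := A.ctx ++ (B.ctx ++ C.ctx)) (B := (A.ctx ++ B.ctx) ++ C.ctx)
    (Ren.app (Ren.app (Ren.inl (B.ctx ++ C.ctx)) ((Ren.inl C.ctx).comp (Ren.inr A.ctx)))
      ((Ren.inr B.ctx).comp (Ren.inr A.ctx))) := rfl

theorem associator_hom_eq_cograph (A B C : Cl T) : (α_ A B C).hom =
    cograph (A := (A.ctx ++ B.ctx) ++ C.ctx) (B := A.ctx ++ (B.ctx ++ C.ctx))
    (Ren.app (Ren.app (Ren.inl (B.ctx ++ C.ctx)) ((Ren.inl C.ctx).comp (Ren.inr A.ctx)))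
      ((Ren.inr B.ctx).comp (Ren.inr A.ctx))) :=
  graph_eq_cograph (Ren.ext' <| Ren.app_cases (by simp) (Ren.app_cases (by simp) (by simp)))
    (Ren.ext' <| Ren.app_cases (Ren.app_cases (by simp) (by simp)) (by simp))

theorem leftUnitor_hom_eq (A : Cl T) :
    (λ_ A).hom = graph (A := [] ++ A.ctx) (B := A.ctx) (Ren.inr []) := rfl

theorem leftUnitor_inv_eq (A : Cl T) : (λ_ A).inv =
    graph (A := A.ctx) (B := [] ++ A.ctx) (Ren.app Ren.nil (Ren.id A.ctx)) := rfl

theorem leftUnitor_hom_eq_cograph (A : Cl T) : (λ_ A).hom =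
    cograph (A := [] ++ A.ctx) (B := A.ctx) (Ren.app Ren.nil (Ren.id A.ctx)) :=
  graph_eq_cograph (by ext; simp) (Ren.app_ext (fun _ z => nomatch z) (by simp))

theorem rightUnitor_hom_eq (A : Cl T) :
    (ρ_ A).hom = graph (A := A.ctx ++ []) (B := A.ctx) (Ren.inl []) := rfl

theorem rightUnitor_inv_eq (A : Cl T) : (ρ_ A).inv =
    graph (A := A.ctx) (B := A.ctx ++ []) (Ren.app (Ren.id A.ctx) Ren.nil) := rfl

theorem rightUnitor_hom_eq_cograph (A : Cl T) : (ρ_ A).hom =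
    cograph (A := A.ctx ++ []) (B := A.ctx) (Ren.app (Ren.id A.ctx) Ren.nil) :=
  graph_eq_cograph (by ext; simp) (Ren.app_ext (by simp) (fun _ z => nomatch z))

theorem tensor_comp {A B C A' B' C' : List T.sig.Ty}
    (R : Quiver.Hom (V := Cl T) ⟨A⟩ ⟨B⟩) (S : Quiver.Hom (V := Cl T) ⟨B⟩ ⟨C⟩)
    (R' : Quiver.Hom (V := Cl T) ⟨A'⟩ ⟨B'⟩) (S' : Quiver.Hom (V := Cl T) ⟨B'⟩ ⟨C'⟩) :
    CategoryStruct.comp (obj := Cl T) (tensor R R') (tensor S S') = tensor (R ≫ S) (R' ≫ S') := by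
  refine hom_ext fun Ξ χ a c => ⟨fun h => ?_, fun h => ?_⟩
  · refine holds_comp_elim h fun Ξ' ρ b χ' hχ h₁ h₂ => ?_
    rw [holds_tensor] at *
    exact ⟨holds_comp_intro _ h₁.1 h₂.1, holds_comp_intro _ h₁.2 h₂.2⟩
  · rw [holds_tensor] at h
    refine holds_comp_elim h.1 fun Ξ₁ ρ₁ b χ₁ hχ₁ h₁ h₂ => ?_
    refine holds_comp_elim (h.2.map ρ₁ hχ₁) fun Ξ₂ ρ₂ b' χ₂ hχ₂ h₃ h₄ => ?_
    refine holds_comp_intro (Ren.app (b.comp ρ₂) b') ?_ ?_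
    · rw [holds_tensor]
      refine ⟨?_, ?_⟩
      · rw [Ren.inl_comp_app]; exact h₁.map ρ₂ hχ₂
      · rw [Ren.inr_comp_app]; exact h₃
    · rw [holds_tensor]
      refine ⟨?_, ?_⟩
      · rw [Ren.inl_comp_app]; exact h₂.map ρ₂ hχ₂
      · rw [Ren.inr_comp_app]; exact h₄

instance : MonoidalCategory (Cl T) := MonoidalCategory.ofTensorHom
  (id_tensorHom_id := fun A B => by
    rw [tensorHom_eq, id_eq_graph, id_eq_graph, graph_tensor, id_eq_graph]
    congr 1
    dsimp only [tensor_ctx, unit_ctx]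
    exact Ren.ext' <| Ren.app_cases (by simp) (by simp))
  (tensorHom_comp_tensorHom := fun R R' S S' => tensor_comp R S R' S')
  (associator_naturality := fun {A B C A' B' C'} R S Q => by
    refine hom_ext fun Ξ χ a b => ?_
    rw [associator_hom_eq_cograph, associator_hom_eq, holds_comp_cograph, holds_graph_comp]
    simp only [tensorHom_eq]
    rw [holds_tensor, holds_tensor, holds_tensor, holds_tensor, and_assoc]
    refine and_congr (iff_of_eq ?_) (and_congr (iff_of_eq ?_) (iff_of_eq ?_)) <;>
    · dsimp only [tensor_ctx]
      congr 1 <;> ext <;> simp)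
  (leftUnitor_naturality := fun {A B} R => by
    refine hom_ext fun Ξ χ a b => ?_
    rw [leftUnitor_hom_eq_cograph, leftUnitor_hom_eq, holds_comp_cograph, holds_graph_comp]
    simp only [tensorHom_eq]
    rw [holds_tensor]
    refine ⟨fun h => ?_, fun h => ⟨?_, ?_⟩⟩
    · exact h.2
    · exact holds_graph.2 fun _ z => nomatch z
    · exact h)
  (rightUnitor_naturality := fun {A B} R => by
    refine hom_ext fun Ξ χ a b => ?_
    rw [rightUnitor_hom_eq_cograph, rightUnitor_hom_eq, holds_comp_cograph, holds_graph_comp]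
    simp only [tensorHom_eq]
    rw [holds_tensor]
    have e : (Ren.inl (𝟙_ (Cl T)).ctx).comp ((Ren.app (Ren.id B.ctx) Ren.nil).comp b) = b := by
      dsimp only [unit_ctx]; ext; simp
    rw [e]
    refine ⟨fun h => h.1, fun h => ⟨h, ?_⟩⟩
    · exact holds_graph.2 fun _ z => nomatch z)
  (pentagon := fun A B C D => by
    simp only [tensorHom_eq, associator_hom_eq, id_eq_graph]
    erw [graph_tensor, graph_tensor, graph_comp, graph_comp, graph_comp]
    congr 1
    dsimp only [tensor_ctx, unit_ctx]
    exact Ren.ext' <| Ren.app_cases (by simp) (Ren.app_cases (by simp) (Ren.app_cases (by simp) (by simp))))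
  (triangle := fun A B => by
    simp only [tensorHom_eq, associator_hom_eq, id_eq_graph, leftUnitor_hom_eq, rightUnitor_hom_eq]
    erw [graph_tensor, graph_tensor, graph_comp]
    congr 1
    dsimp only [tensor_ctx, unit_ctx]
    exact Ren.ext' <| Ren.app_cases (by simp) (by simp))

/-- The braiding `[x⃗ : A, y⃗ : B; y⃗' : B, x⃗' : A ∣ x⃗ = x⃗' ∧ y⃗ = y⃗']`. -/
def braid (A B : Cl T) : A ⊗ B ≅ B ⊗ A :=
  graphIso (A := A.ctx ++ B.ctx) (B := B.ctx ++ A.ctx)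
    (Ren.app (Ren.inr A.ctx) (Ren.inl B.ctx)) (Ren.app (Ren.inr B.ctx) (Ren.inl A.ctx))
    (Ren.app_ext (by simp) (by simp)) (Ren.app_ext (by simp) (by simp))

theorem braid_hom_eq (A B : Cl T) : (braid A B).hom =
    graph (A := A.ctx ++ B.ctx) (B := B.ctx ++ A.ctx)
      (Ren.app (Ren.inr A.ctx) (Ren.inl B.ctx)) := rfl

theorem braid_hom_eq_cograph (A B : Cl T) : (braid A B).hom =
    cograph (A := A.ctx ++ B.ctx) (B := B.ctx ++ A.ctx)
      (Ren.app (Ren.inr B.ctx) (Ren.inl A.ctx)) :=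
  graph_eq_cograph (Ren.app_ext (by simp) (by simp)) (Ren.app_ext (by simp) (by simp))

theorem braid_naturality {A B C D : Cl T} (R : A ⟶ B) (S : C ⟶ D) :
    tensor R S ≫ (braid B D).hom = (braid A C).hom ≫ tensor S R := by
  refine hom_ext fun Ξ χ a b => ?_
  rw [braid_hom_eq_cograph, braid_hom_eq, holds_comp_cograph, holds_graph_comp]
  rw [holds_tensor, holds_tensor, and_comm]
  refine and_congr (iff_of_eq ?_) (iff_of_eq ?_) <;>
  · congr 1 <;> ext <;> simp

instance : SymmetricCategory (Cl T) where
  braiding := braid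
  braiding_naturality_right A _ _ R := braid_naturality (𝟙 A) R
  braiding_naturality_left R A := braid_naturality R (𝟙 A)
  hexagon_forward A B C := by
    simp only [whiskerRight_eq, whiskerLeft_eq, associator_hom_eq, id_eq_graph, braid_hom_eq]
    erw [graph_tensor, graph_tensor, graph_comp, graph_comp, graph_comp, graph_comp]
    congr 1
    dsimp only [tensor_ctx, unit_ctx]
    exact Ren.ext' <| Ren.app_cases (by simp) (Ren.app_cases (by simp) (by simp))
  hexagon_reverse A B C := by
    simp only [whiskerRight_eq, whiskerLeft_eq, associator_inv_eq, id_eq_graph, braid_hom_eq]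
    erw [graph_tensor, graph_tensor, graph_comp, graph_comp, graph_comp, graph_comp]
    congr 1
    dsimp only [tensor_ctx, unit_ctx]
    exact Ren.ext' <| Ren.app_cases (Ren.app_cases (by simp) (by simp)) (by simp)
  symmetry A B := (braid A B).hom_inv_id

/-- The duplication morphism `[x⃗ : A; x⃗' : A, x⃗'' : A ∣ x⃗ = x⃗' ∧ x⃗ = x⃗'']` and the deletion
morphism `[x⃗ : A ∣ ⊤]`. -/
instance (A : Cl T) : ComonObj A where
  comul := graph (A := A.ctx) (B := A.ctx ++ A.ctx) (Ren.app (Ren.id A.ctx) (Ren.id A.ctx))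
  counit := graph (A := A.ctx) (B := []) Ren.nil
  counit_comul := by
    rw [whiskerRight_eq, id_eq_graph, leftUnitor_inv_eq]
    erw [graph_tensor, graph_comp]
    congr 1
    exact Ren.ext' <| Ren.app_cases (Γ := []) (fun _ z => nomatch z)
      fun _ z => Ren.app_inr (Ren.id A.ctx) (Ren.id A.ctx) z
  comul_counit := by
    rw [whiskerLeft_eq, id_eq_graph, rightUnitor_inv_eq]
    erw [graph_tensor, graph_comp]
    congr 1
    dsimp only [tensor_ctx, unit_ctx]
    exact Ren.ext' <| Ren.app_cases (by simp) (fun _ z => nomatch z)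
  comul_assoc := by
    rw [whiskerRight_eq, whiskerLeft_eq, id_eq_graph, associator_hom_eq]
    erw [graph_tensor, graph_tensor, graph_comp, graph_comp, graph_comp]
    congr 1
    dsimp only [tensor_ctx, unit_ctx]
    exact Ren.ext' <| Ren.app_cases (by simp) (Ren.app_cases (by simp) (by simp))

theorem comul_eq (A : Cl T) : ComonObj.comul (X := A) =
    graph (A := A.ctx) (B := A.ctx ++ A.ctx) (Ren.app (Ren.id A.ctx) (Ren.id A.ctx)) := rfl

theorem counit_eq (A : Cl T) : ComonObj.counit (X := A) =
    graph (A := A.ctx) (B := []) Ren.nil := rfl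

theorem braiding_hom_eq (A B : Cl T) : (β_ A B).hom =
    graph (A := A.ctx ++ B.ctx) (B := B.ctx ++ A.ctx)
      (Ren.app (Ren.inr A.ctx) (Ren.inl B.ctx)) := rfl

instance : CopyDiscardCategory (Cl T) where
  isCommComonObj A := ⟨by
    rw [comul_eq, braiding_hom_eq]
    erw [graph_comp]
    congr 1
    exact Ren.ext' <| Ren.app_cases (by simp) (by simp)⟩
  copy_tensor A B := by
    simp only [tensorμ, tensorHom_eq, whiskerLeft_eq, whiskerRight_eq, associator_hom_eq,
      associator_inv_eq, comul_eq, braiding_hom_eq, id_eq_graph]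
    erw [graph_tensor, graph_tensor, graph_tensor, graph_tensor, graph_tensor, graph_comp,
      graph_comp, graph_comp, graph_comp, graph_comp]
    congr 1
    dsimp only [tensor_ctx, unit_ctx]
    exact Ren.ext' <| Ren.app_cases (Ren.app_cases (by simp) (by simp)) (Ren.app_cases (by simp) (by simp))
  discard_tensor A B := by
    simp only [tensorHom_eq, counit_eq, leftUnitor_hom_eq]
    erw [graph_tensor, graph_comp]
    congr 1
    ext _ z; exact nomatch z
  copy_unit := by
    rw [comul_eq, leftUnitor_inv_eq]
    congr 1
  discard_unit := by
    rw [counit_eq, id_eq_graph]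
    congr 1
    ext _ z; exact nomatch z

theorem id_le_graph_cograph {A B : List T.sig.Ty} (f : Ren B A) :
    𝟙 (⟨A⟩ : Cl T) ≤ graph f ≫ cograph f := by
  refine le_iff.2 fun Ξ χ a b h => ?_
  rw [holds_comp_cograph, holds_graph]
  exact fun S z => holds_graph.1 h S (f z)

theorem cograph_graph_le_id {A B : List T.sig.Ty} (f : Ren B A) :
    cograph f ≫ graph f ≤ 𝟙 (⟨B⟩ : Cl T) := by
  refine le_iff.2 fun Ξ χ a b h => ?_
  refine holds_comp_elim h fun Ξ' ρ c χ' hχ h₁ h₂ => ?_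
  exact holds_graph.2 fun S z => (holds_cograph.1 h₁ S z).trans_eq (holds_graph.1 h₂ S z)

/-- The classifying category of a regular theory is a bicategory of relations. -/
instance : BicategoryOfRelations (Cl T) where
  homOrder := homOrder
  comp_mono {A B C R R' S S'} h h' := le_iff.2 fun Ξ χ a c k =>
    holds_comp_elim k fun Ξ' ρ b χ' hχ h₁ h₂ =>
      holds_comp_intro b (le_iff.1 h _ _ _ _ h₁) (le_iff.1 h' _ _ _ _ h₂)
  tensor_mono {A B C D R R' S S'} h h' := le_iff.2 fun Ξ χ a b k =>
    holds_tensor.2 ⟨le_iff.1 h _ _ _ _ (holds_tensor.1 k).1, le_iff.1 h' _ _ _ _ (holds_tensor.1 k).2⟩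
  lax_copy {A B} R := le_iff.2 fun Ξ χ a c k => by
    refine holds_comp_elim k fun Ξ' ρ b χ' hχ h₁ h₂ => ?_
    have h₂' := holds_graph.1 h₂
    rw [comul_eq, holds_graph_comp]
    refine holds_tensor.2 ⟨?_, ?_⟩
    · convert h₁.congr (a' := a.comp ρ) (b' := (Ren.inl B.ctx).comp (c.comp ρ))
        (fun _ _ => .eq_refl _ _) (fun S z => by simpa using h₂' S (Ren.inl _ z)) using 1
      ext; simp
    · convert h₁.congr (a' := a.comp ρ) (b' := (Ren.inr B.ctx).comp (c.comp ρ))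
        (fun _ _ => .eq_refl _ _) (fun S z => by simpa using h₂' S (Ren.inr _ z)) using 1
      ext; simp
  lax_discard {A B} R := le_iff.2 fun Ξ χ a c k => holds_graph.2 fun _ z => nomatch z
  merge A := cograph (A := A.ctx ++ A.ctx) (B := A.ctx) (Ren.app (Ren.id A.ctx) (Ren.id A.ctx))
  create A := cograph (A := []) (B := A.ctx) Ren.nil
  id_le_copy_merge A := id_le_graph_cograph _
  merge_copy_le_id A := cograph_graph_le_id _
  id_le_discard_create A := id_le_graph_cograph _
  create_discard_le_id A := cograph_graph_le_id _
  frobenius_left A := by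
    rw [whiskerLeft_eq, whiskerRight_eq, comul_eq, associator_inv_eq, id_eq_graph]
    rw [graph_eq_cograph (f := Ren.id A.ctx) (g := Ren.id A.ctx) rfl rfl]
    erw [cograph_tensor, ← graph_eq_cograph (f := Ren.id A.ctx) (g := Ren.id A.ctx) rfl rfl,
      graph_tensor]
    refine hom_ext fun Ξ χ a c => ?_
    erw [holds_graph_comp, holds_graph_comp]
    dsimp only [tensor_ctx] at a c ⊢
    refine ⟨fun h => ?_, fun h => holds_comp_elim h fun Ξ' ρ b χ' hχ h₁ h₂ => ?_⟩
    · replace h := holds_cograph.1 h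
      have h1 : ∀ S (z : Var A.ctx S), Entails T χ (eq (a (Ren.inl _ z)) (c (Ren.inl _ z))) :=
        fun S z => by simpa using h S (Ren.inl _ (Ren.inl _ z))
      have h2 : ∀ S (z : Var A.ctx S), Entails T χ (eq (a (Ren.inr _ z)) (c (Ren.inl _ z))) :=
        fun S z => by simpa using h S (Ren.inl _ (Ren.inr _ z))
      have h3 : ∀ S (z : Var A.ctx S), Entails T χ (eq (a (Ren.inr _ z)) (c (Ren.inr _ z))) :=
        fun S z => by simpa using h S (Ren.inr _ z)
      refine holds_comp_intro ((Ren.inl A.ctx).comp c) (holds_cograph.2 ?_) (holds_graph.2 ?_)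
      · exact Ren.app_cases (by simpa using h1) (by simpa using h2)
      · refine Ren.app_cases (fun S z => ?_) (fun S z => ?_)
        · simpa using Entails.eq_refl _ _
        · simpa using (h2 S z).symm_eq.trans_eq (h3 S z)
    · replace h₁ := holds_cograph.1 h₁
      replace h₂ := holds_graph.1 h₂
      have h1 : ∀ S (z : Var A.ctx S), Entails T χ' (eq (ρ (a (Ren.inl _ z))) (b z)) :=
        fun S z => by simpa using h₁ S (Ren.inl _ z)
      have h2 : ∀ S (z : Var A.ctx S), Entails T χ' (eq (ρ (a (Ren.inr _ z))) (b z)) :=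
        fun S z => by simpa using h₁ S (Ren.inr _ z)
      have h3 : ∀ S (z : Var A.ctx S), Entails T χ' (eq (b z) (ρ (c (Ren.inl _ z)))) :=
        fun S z => by simpa using h₂ S (Ren.inl _ z)
      have h4 : ∀ S (z : Var A.ctx S), Entails T χ' (eq (b z) (ρ (c (Ren.inr _ z)))) :=
        fun S z => by simpa using h₂ S (Ren.inr _ z)
      refine holds_cograph.2 (Ren.app_cases (Ren.app_cases ?_ ?_) ?_)
      · intro S z; simpa using (h1 S z).trans_eq (h3 S z)
      · intro S z; simpa using (h2 S z).trans_eq (h3 S z)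
      · intro S z; simpa using (h2 S z).trans_eq (h4 S z)
  frobenius_right A := by
    rw [whiskerLeft_eq, whiskerRight_eq, comul_eq, associator_hom_eq, id_eq_graph]
    erw [graph_tensor]
    rw [graph_eq_cograph (f := Ren.id A.ctx) (g := Ren.id A.ctx) rfl rfl]
    erw [cograph_tensor]
    refine hom_ext fun Ξ χ a c => ?_
    erw [holds_graph_comp, holds_graph_comp]
    dsimp only [tensor_ctx] at a c ⊢
    refine ⟨fun h => ?_, fun h => holds_comp_elim h fun Ξ' ρ b χ' hχ h₁ h₂ => ?_⟩
    · replace h := holds_cograph.1 h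
      have h1 : ∀ S (z : Var A.ctx S), Entails T χ (eq (a (Ren.inl _ z)) (c (Ren.inl _ z))) :=
        fun S z => by simpa using h S (Ren.inl _ z)
      have h2 : ∀ S (z : Var A.ctx S), Entails T χ (eq (a (Ren.inl _ z)) (c (Ren.inr _ z))) :=
        fun S z => by simpa using h S (Ren.inr _ (Ren.inl _ z))
      have h3 : ∀ S (z : Var A.ctx S), Entails T χ (eq (a (Ren.inr _ z)) (c (Ren.inr _ z))) :=
        fun S z => by simpa using h S (Ren.inr _ (Ren.inr _ z))
      refine holds_comp_intro ((Ren.inr A.ctx).comp c) (holds_cograph.2 ?_) (holds_graph.2 ?_)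
      · exact Ren.app_cases (by simpa using h2) (by simpa using h3)
      · refine Ren.app_cases (fun S z => ?_) (fun S z => ?_)
        · simpa using (h2 S z).symm_eq.trans_eq (h1 S z)
        · simpa using Entails.eq_refl _ _
    · replace h₁ := holds_cograph.1 h₁
      replace h₂ := holds_graph.1 h₂
      have h1 : ∀ S (z : Var A.ctx S), Entails T χ' (eq (ρ (a (Ren.inl _ z))) (b z)) :=
        fun S z => by simpa using h₁ S (Ren.inl _ z)
      have h2 : ∀ S (z : Var A.ctx S), Entails T χ' (eq (ρ (a (Ren.inr _ z))) (b z)) :=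
        fun S z => by simpa using h₁ S (Ren.inr _ z)
      have h3 : ∀ S (z : Var A.ctx S), Entails T χ' (eq (b z) (ρ (c (Ren.inl _ z)))) :=
        fun S z => by simpa using h₂ S (Ren.inl _ z)
      have h4 : ∀ S (z : Var A.ctx S), Entails T χ' (eq (b z) (ρ (c (Ren.inr _ z)))) :=
        fun S z => by simpa using h₂ S (Ren.inr _ z)
      refine holds_cograph.2 (Ren.app_cases ?_ (Ren.app_cases ?_ ?_))
      · intro S z; simpa using (h1 S z).trans_eq (h3 S z)
      · intro S z; simpa using (h1 S z).trans_eq (h4 S z)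
      · intro S z; simpa using (h2 S z).trans_eq (h4 S z)

end Cl

/-! ### Interpretations and the internal language of a bicategory of relations -/

section Interpretations

open BicategoryOfRelations
open scoped ComonObj

variable {B : Type u} [Category.{v} B] [MonoidalCategory B]

/-- The object `⟦A₁⟧ ⊗ (⟦A₂⟧ ⊗ ⋯ (⟦Aₙ⟧ ⊗ I))`, for an assignment `⟦·⟧` of objects to basic types. -/
def ctxObj {T : Type u₁} (ty : T → B) : List T → B
  | [] => 𝟙_ B
  | A :: Γ => ty A ⊗ ctxObj ty Γ

/-- An interpretation of a signature in a bicategory of relations. -/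
structure Interpretation (S : Signature.{u₁, v₁}) (B : Type u) [Category.{v} B]
    [MonoidalCategory B] where
  ty : S.Ty → B
  rel (R : S.Rel) : ctxObj ty (S.arity R) ⟶ 𝟙_ B

namespace Interpretation

variable [BicategoryOfRelations B] {S : Signature.{u₁, v₁}} (I : Interpretation S B)

/-- The interpretation of a variable: delete all other variables of the context. -/
def var : ∀ {Γ : List S.Ty} {A : S.Ty}, Var Γ A → (ctxObj I.ty Γ ⟶ I.ty A)
  | A :: Γ, _, .zero => I.ty A ◁ ε[ctxObj I.ty Γ] ≫ (ρ_ (I.ty A)).hom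
  | A :: Γ, _, .succ x => ε[I.ty A] ▷ ctxObj I.ty Γ ≫ (λ_ (ctxObj I.ty Γ)).hom ≫ var x

/-- The interpretation of a tuple of variables: copy the context and take the components. -/
def tuple {Ξ : List S.Ty} : ∀ {Γ : List S.Ty}, Ren Γ Ξ → (ctxObj I.ty Ξ ⟶ ctxObj I.ty Γ)
  | [], _ => ε[ctxObj I.ty Ξ]
  | _ :: _, x => Δ[ctxObj I.ty Ξ] ≫ (I.var (x .zero) ⊗ₘ tuple x.tail)

/-- The interpretation `⟦Γ ∣ φ⟧ : ⟦Γ⟧ ⟶ I` of a formula in context.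
Equality of two variables of type `A` is obtained by applying the counit `merge A ≫ ε[A]` of the
self-duality of `A` to the two variables, and existential quantification by plugging `create A`
into the wire of the bound variable.  (Bending that wire to an output, this amounts to
`⟦Γ ∣ ∃ x : A. φ⟧ = ⟦Γ; x : A ∣ φ⟧ ≫ ε[A]`.) -/
def formula : ∀ {Γ : List S.Ty}, Formula S Γ → (ctxObj I.ty Γ ⟶ 𝟙_ B)
  | _, .rel R x => I.tuple x ≫ I.rel R
  | Γ, .eq (A := A) x y =>
      Δ[ctxObj I.ty Γ] ≫ (I.var x ⊗ₘ I.var y) ≫ merge (I.ty A) ≫ ε[I.ty A]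
  | Γ, .top => ε[ctxObj I.ty Γ]
  | Γ, .and φ ψ => Δ[ctxObj I.ty Γ] ≫ (formula φ ⊗ₘ formula ψ) ≫ merge (𝟙_ B)
  | Γ, .ex A φ =>
      (λ_ (ctxObj I.ty Γ)).inv ≫ create (I.ty A) ▷ ctxObj I.ty Γ ≫ formula φ

end Interpretation

variable (B) in
/-- The signature of the internal language of `B`: the types are the objects of `B`, and the
relation symbols `R : (A₁, …, Aₙ)` are the morphisms `R : A₁ ⊗ ⋯ ⊗ Aₙ ⟶ I` of `B`. -/
def langSig : Signature.{u, max u v} where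
  Ty := B
  Rel := Σ Γ : List B, (ctxObj (fun A : B => A) Γ ⟶ 𝟙_ B)
  arity R := R.1

variable (B) in
/-- The canonical interpretation in `B` of the signature of the internal language of `B`. -/
def langInterpretation : Interpretation (langSig B) B where
  ty A := A
  rel R := R.2

variable (B) in
/-- The internal language of `B`: its axioms are all sequents `Γ ∣ φ ⊢ ψ` with
`⟦Γ ∣ φ⟧ ≤ ⟦Γ ∣ ψ⟧` in `B`. -/
def Lang [BicategoryOfRelations B] : RegularTheory.{u, max u v} where
  sig := langSig B
  ax := {s | (langInterpretation B).formula s.hyp ≤ (langInterpretation B).formula s.concl}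

end Interpretations

end RegularLogic

-- Each object is self-dual: the Frobenius equations make `merge X ≫ ε[X]` and `create X ≫ Δ[X]` the
-- counit and unit of a duality. Hence morphisms `X ⟶ Y` correspond, monotonically in both
-- directions, to predicates `X ⊗ Y ⟶ 𝟙_ C` (`name` and `bend`), and a formula whose context is
-- split into inputs and outputs denotes a morphism.
--
-- The rules of regular logic hold for predicates. Laxness of copying and discarding gives finite
-- meets (`le_conj`, `conj_le_left`). Substitution is precomposition with a map, and quantification
-- is left adjoint to precomposition with a projection (`createLeft_comp_le_iff`), stable under
-- substitution (`createLeft_naturality`) and satisfying Frobenius reciprocity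
-- (`conj_createLeft_le`). Equality is the counit of the duality (`discard_le_eq_self`,
-- `conj_eq_comp_le`). This yields soundness, `Interpretation.IsModel.sound`, so every model induces
-- a monotone functor on `Cl T`. Composition is preserved because bending and composing is
-- quantification over the middle wire (`name_bend_comp`, `hom_compF`).
--
-- Most bookkeeping takes place among maps, the morphisms with a right adjoint. They are strict
-- comonoid homomorphisms, so `⊗` is a cartesian product for them and coherence equations are
-- checked on projections.
--
-- For `Lang B` the canonical functor is an equivalence almost by construction. It reflects the
-- order because every valid sequent is an axiom, it is full because the name of any morphism is an
-- atom, and it is essentially surjective because `[A]` goes to `A ⊗ 𝟙_ B`. Since it reflects the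
-- order, its inverse is structure-preserving too. Strictness reduces to the fact that reassociating
-- lists does not change the positions of variables, and to an induction on contexts.

attribute [reducible] RegularLogic.ctxObj

/-! ### Maps in a bicategory of relations -/

namespace BicategoryOfRelations

open scoped ComonObj

variable {C : Type u} [Category.{v} C] [MonoidalCategory C] [BicategoryOfRelations C]
variable {W X Y Z X' Y' : C}

theorem whiskerRight_mono {R S : X ⟶ Y} (h : R ≤ S) (Z : C) : R ▷ Z ≤ S ▷ Z := by
  rw [← tensorHom_id, ← tensorHom_id]; exact tensor_mono h le_rfl

theorem comp_mono_left (R : X ⟶ Y) {S S' : Y ⟶ Z} (h : S ≤ S') : R ≫ S ≤ R ≫ S' :=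
  comp_mono le_rfl h

theorem comp_mono_right {R R' : X ⟶ Y} (h : R ≤ R') (S : Y ⟶ Z) : R ≫ S ≤ R' ≫ S :=
  comp_mono h le_rfl

/-- A map is a morphism with a right adjoint. -/
class IsMap (f : X ⟶ Y) : Prop where
  exists_rightAdjoint : ∃ g : Y ⟶ X, 𝟙 X ≤ f ≫ g ∧ g ≫ f ≤ 𝟙 Y

/-- `g' ≤ g' ≫ f ≫ g ≤ g`. The resulting uniqueness of right adjoints is how equations about `merge`
and `create` are proved: both sides are shown to be adjoint to the same map. -/
theorem rightAdjoint_le {f : X ⟶ Y} {g g' : Y ⟶ X} (h : 𝟙 X ≤ f ≫ g) (h' : g' ≫ f ≤ 𝟙 Y) :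
    g' ≤ g := by
  have h1 := comp_mono_left g' h
  have h2 := comp_mono_right h' g
  simp only [Category.comp_id, Category.id_comp, Category.assoc] at h1 h2
  exact h1.trans h2

theorem rightAdjoint_unique {f : X ⟶ Y} {g g' : Y ⟶ X} (h : 𝟙 X ≤ f ≫ g) (k : g ≫ f ≤ 𝟙 Y)
    (h' : 𝟙 X ≤ f ≫ g') (k' : g' ≫ f ≤ 𝟙 Y) : g = g' :=
  le_antisymm (rightAdjoint_le h' k) (rightAdjoint_le h k')

theorem comp_adjoint {f : X ⟶ Y} {g : Y ⟶ X} {f' : Y ⟶ Z} {g' : Z ⟶ Y} (h : 𝟙 X ≤ f ≫ g)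
    (k : g ≫ f ≤ 𝟙 Y) (h' : 𝟙 Y ≤ f' ≫ g') (k' : g' ≫ f' ≤ 𝟙 Z) :
    𝟙 X ≤ (f ≫ f') ≫ g' ≫ g ∧ (g' ≫ g) ≫ f ≫ f' ≤ 𝟙 Z := by
  constructor
  · have := comp_mono_left f (comp_mono_right h' g)
    simp only [Category.id_comp, Category.assoc] at this ⊢
    exact h.trans this
  · have := comp_mono_left g' (comp_mono_right k f')
    simp only [Category.id_comp, Category.assoc] at this ⊢
    exact this.trans k'

theorem tensor_adjoint {f : X ⟶ Y} {g : Y ⟶ X} {f' : X' ⟶ Y'} {g' : Y' ⟶ X'} (h : 𝟙 X ≤ f ≫ g)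
    (k : g ≫ f ≤ 𝟙 Y) (h' : 𝟙 X' ≤ f' ≫ g') (k' : g' ≫ f' ≤ 𝟙 Y') :
    𝟙 (X ⊗ X') ≤ (f ⊗ₘ f') ≫ (g ⊗ₘ g') ∧ (g ⊗ₘ g') ≫ (f ⊗ₘ f') ≤ 𝟙 (Y ⊗ Y') := by
  rw [tensorHom_comp_tensorHom, tensorHom_comp_tensorHom, ← id_tensorHom_id, ← id_tensorHom_id]
  exact ⟨tensor_mono h h', tensor_mono k k'⟩

instance (priority := low) (f : X ⟶ Y) [IsIso f] : IsMap f :=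
  ⟨inv f, by simp, by simp⟩

instance (f : X ⟶ Y) (g : Y ⟶ Z) [hf : IsMap f] [hg : IsMap g] : IsMap (f ≫ g) := by
  obtain ⟨f', h, k⟩ := hf
  obtain ⟨g', h', k'⟩ := hg
  exact ⟨g' ≫ f', comp_adjoint h k h' k'⟩

instance (f : X ⟶ Y) (g : X' ⟶ Y') [hf : IsMap f] [hg : IsMap g] : IsMap (f ⊗ₘ g) := by
  obtain ⟨f', h, k⟩ := hf
  obtain ⟨g', h', k'⟩ := hg
  exact ⟨f' ⊗ₘ g', tensor_adjoint h k h' k'⟩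

instance (f : X ⟶ Y) [IsMap f] : IsMap (f ▷ Z) := by rw [← tensorHom_id]; infer_instance

instance (f : X ⟶ Y) [IsMap f] : IsMap (Z ◁ f) := by rw [← id_tensorHom]; infer_instance

instance : IsMap Δ[X] := ⟨merge X, id_le_copy_merge X, merge_copy_le_id X⟩

instance : IsMap ε[X] := ⟨create X, id_le_discard_create X, create_discard_le_id X⟩

/-- Laxness of the right adjoint `g` gives the missing inequality: `Δ ≫ (f ⊗ₘ f) ≤ f ≫ g ≫ Δ ≫ (f ⊗ₘ
f) ≤ f ≫ Δ ≫ (g ≫ f ⊗ₘ g ≫ f) ≤ f ≫ Δ`. The same device works for `map_discard`. -/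
theorem map_copy (f : X ⟶ Y) [hf : IsMap f] : f ≫ Δ[Y] = Δ[X] ≫ (f ⊗ₘ f) := by
  obtain ⟨g, h, k⟩ := hf
  refine le_antisymm (lax_copy f) ?_
  have h1 := comp_mono_right h (Δ[X] ≫ (f ⊗ₘ f))
  have h2 := comp_mono_left f (comp_mono_right (lax_copy g) (f ⊗ₘ f))
  have h3 := comp_mono_left f (comp_mono_left Δ[Y] (tensor_mono k k))
  simp only [Category.id_comp, Category.assoc, tensorHom_comp_tensorHom, id_tensorHom_id,
    Category.comp_id] at h1 h2 h3
  exact h1.trans (h2.trans h3)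

theorem map_discard (f : X ⟶ Y) [hf : IsMap f] : f ≫ ε[Y] = ε[X] := by
  obtain ⟨g, h, k⟩ := hf
  refine le_antisymm (lax_discard f) ?_
  have h1 := comp_mono_right h ε[X]
  have h2 := comp_mono_left f (lax_discard g)
  simp only [Category.id_comp, Category.assoc] at h1 h2
  exact h1.trans h2

@[simp] theorem discard_tensorUnit : ε[𝟙_ C] = 𝟙 (𝟙_ C) := CopyDiscardCategory.discard_unit

/-- Maps into the unit object are unique. -/
theorem map_unit_ext (f g : X ⟶ 𝟙_ C) [IsMap f] [IsMap g] : f = g := by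
  have h1 := map_discard f
  have h2 := map_discard g
  simp only [discard_tensorUnit, Category.comp_id] at h1 h2
  rw [h1, h2]

theorem eq_discard (f : X ⟶ 𝟙_ C) [IsMap f] : f = ε[X] := map_unit_ext f ε[X]

/-! ### The tensor product as a cartesian product for maps. -/

/-- The first projection. -/
def fst (X Y : C) : X ⊗ Y ⟶ X := X ◁ ε[Y] ≫ (ρ_ X).hom

/-- The second projection. -/
def snd (X Y : C) : X ⊗ Y ⟶ Y := ε[X] ▷ Y ≫ (λ_ Y).hom

/-- The pairing of two morphisms, a cartesian pairing in the case of maps. -/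
def pair (f : W ⟶ X) (g : W ⟶ Y) : W ⟶ X ⊗ Y := Δ[W] ≫ (f ⊗ₘ g)

instance : IsMap (fst X Y) := by unfold fst; infer_instance

instance : IsMap (snd X Y) := by unfold snd; infer_instance

instance (f : W ⟶ X) (g : W ⟶ Y) [IsMap f] [IsMap g] : IsMap (pair f g) := by
  unfold pair; infer_instance

theorem pair_tensor (f : W ⟶ X) (g : W ⟶ Y) (h : X ⟶ X') (k : Y ⟶ Y') :
    pair f g ≫ (h ⊗ₘ k) = pair (f ≫ h) (g ≫ k) := by
  simp [pair]

theorem pair_tensor_assoc (f : W ⟶ X) (g : W ⟶ Y) (h : X ⟶ X') (k : Y ⟶ Y') (l : X' ⊗ Y' ⟶ Z) :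
    pair f g ≫ (h ⊗ₘ k) ≫ l = pair (f ≫ h) (g ≫ k) ≫ l := by
  rw [← pair_tensor, Category.assoc]

@[simp] theorem comp_pair (h : Z ⟶ W) [IsMap h] (f : W ⟶ X) (g : W ⟶ Y) :
    h ≫ pair f g = pair (h ≫ f) (h ≫ g) := by
  rw [pair, ← Category.assoc, map_copy, Category.assoc, tensorHom_comp_tensorHom, pair]

@[simp] theorem comp_pair_assoc (h : Z ⟶ W) [IsMap h] (f : W ⟶ X) (g : W ⟶ Y)
    (k : X ⊗ Y ⟶ X') : h ≫ pair f g ≫ k = pair (h ≫ f) (h ≫ g) ≫ k := by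
  rw [← comp_pair, Category.assoc]

-- Only the discarded component has to be a map; the surviving one may be any relation. This
-- generality is used for pairs of predicates.
@[simp] theorem pair_fst (f : W ⟶ X) (g : W ⟶ Y) [IsMap g] : pair f g ≫ fst X Y = f := by
  rw [pair, fst, Category.assoc, ← Category.assoc (f ⊗ₘ g), ← id_tensorHom,
    tensorHom_comp_tensorHom, Category.comp_id, map_discard, tensorHom_def', Category.assoc,
    rightUnitor_naturality, ← Category.assoc, ComonObj.comul_counit]
  simp

@[simp] theorem pair_snd (f : W ⟶ X) (g : W ⟶ Y) [IsMap f] : pair f g ≫ snd X Y = g := by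
  rw [pair, snd, Category.assoc, ← Category.assoc (f ⊗ₘ g), ← tensorHom_id,
    tensorHom_comp_tensorHom, Category.comp_id, map_discard, MonoidalCategory.tensorHom_def, Category.assoc,
    leftUnitor_naturality, ← Category.assoc, ComonObj.counit_comul]
  simp

@[simp] theorem pair_fst_assoc (f : W ⟶ X) (g : W ⟶ Y) [IsMap g] (h : X ⟶ Z) :
    pair f g ≫ fst X Y ≫ h = f ≫ h := by
  rw [← Category.assoc, pair_fst]

@[simp] theorem pair_snd_assoc (f : W ⟶ X) (g : W ⟶ Y) [IsMap f] (h : Y ⟶ Z) :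
    pair f g ≫ snd X Y ≫ h = g ≫ h := by
  rw [← Category.assoc, pair_snd]

/-- The comultiplication of `X ⊗ Y` is the tensor of those of `X` and `Y` followed by a middle
interchange. Naturality moves the two discards past the interchange, where the counit laws of the
factors apply; only coherence remains. -/
theorem pair_fst_snd (X Y : C) : pair (fst X Y) (snd X Y) = 𝟙 (X ⊗ Y) := by
  rw [pair, CopyDiscardCategory.copy_tensor, fst, snd, ← tensorHom_comp_tensorHom,
    ← id_tensorHom, ← tensorHom_id, Category.assoc, ← Category.assoc (tensorμ X X Y Y),
    ← tensorμ_natural, Category.assoc, ← Category.assoc (Δ[X] ⊗ₘ Δ[Y]), tensorHom_comp_tensorHom,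
    id_tensorHom, tensorHom_id, ComonObj.comul_counit, ComonObj.counit_comul]
  simp only [tensorμ, braiding_tensorUnit_left]
  monoidal

theorem map_ext {f g : W ⟶ X ⊗ Y} [IsMap f] [IsMap g] (h : f ≫ fst X Y = g ≫ fst X Y)
    (k : f ≫ snd X Y = g ≫ snd X Y) : f = g := by
  rw [← Category.comp_id f, ← Category.comp_id g, ← pair_fst_snd, comp_pair, comp_pair, h, k]

theorem tensor_eq_pair (f : X ⟶ X') (g : Y ⟶ Y') :
    f ⊗ₘ g = pair (fst X Y ≫ f) (snd X Y ≫ g) := by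
  rw [← pair_tensor, pair_fst_snd, Category.id_comp]

theorem whiskerRight_eq_pair (f : X ⟶ X') (Y : C) : f ▷ Y = pair (fst X Y ≫ f) (snd X Y) := by
  rw [← tensorHom_id, tensor_eq_pair, Category.comp_id]

theorem whiskerLeft_eq_pair (f : Y ⟶ Y') (X : C) : X ◁ f = pair (fst X Y) (snd X Y ≫ f) := by
  rw [← id_tensorHom, tensor_eq_pair, Category.comp_id]

theorem copy_eq_pair (X : C) : Δ[X] = pair (𝟙 X) (𝟙 X) := by simp [pair]

theorem leftUnitor_hom_eq_snd (X : C) : (λ_ X).hom = snd (𝟙_ C) X := by simp [snd]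

theorem rightUnitor_hom_eq_fst (X : C) : (ρ_ X).hom = fst X (𝟙_ C) := by simp [fst]

/-- Writing the structure isomorphisms as tuples of projections lets `simp` settle coherence
equations by the rules for pairs. -/
theorem associator_hom_eq_pair (X Y Z : C) : (α_ X Y Z).hom =
    pair (fst (X ⊗ Y) Z ≫ fst X Y) (pair (fst (X ⊗ Y) Z ≫ snd X Y) (snd (X ⊗ Y) Z)) := by
  refine map_ext ?_ (map_ext ?_ ?_)
  · rw [pair_fst]
    rw [fst, ← map_discard (fst Y Z)]
    simp [fst]
  · have h : (α_ X Y Z).hom ≫ snd X (Y ⊗ Z) = snd X Y ▷ Z := by simp [snd]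
    rw [Category.assoc, Category.assoc, pair_snd_assoc, pair_fst, ← Category.assoc, h, fst,
      ← whisker_exchange_assoc, fst, Category.assoc, rightUnitor_naturality]
  · simp only [Category.assoc, pair_snd]
    rw [snd, snd, snd, ← map_discard (snd X Y)]
    simp [snd]

theorem associator_inv_eq_pair (X Y Z : C) : (α_ X Y Z).inv =
    pair (pair (fst X (Y ⊗ Z)) (snd X (Y ⊗ Z) ≫ fst Y Z)) (snd X (Y ⊗ Z) ≫ snd Y Z) := by
  rw [← cancel_mono (α_ X Y Z).hom, Iso.inv_hom_id, associator_hom_eq_pair]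
  refine map_ext ?_ (map_ext ?_ ?_) <;> simp

theorem braiding_hom_eq_pair (X Y : C) : (β_ X Y).hom = pair (snd X Y) (fst X Y) := by
  refine map_ext ?_ ?_
  · rw [pair_fst, fst, ← BraidedCategory.braiding_naturality_left_assoc, braiding_rightUnitor, snd]
  · rw [pair_snd, snd, ← BraidedCategory.braiding_naturality_right_assoc, braiding_leftUnitor, fst]

theorem tensorμ_eq_pair (X Y Z W : C) : tensorμ X Y Z W =
    pair (pair (fst (X ⊗ Y) (Z ⊗ W) ≫ fst X Y) (snd (X ⊗ Y) (Z ⊗ W) ≫ fst Z W))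
      (pair (fst (X ⊗ Y) (Z ⊗ W) ≫ snd X Y) (snd (X ⊗ Y) (Z ⊗ W) ≫ snd Z W)) := by
  simp only [tensorμ, associator_hom_eq_pair, associator_inv_eq_pair, whiskerLeft_eq_pair,
    whiskerRight_eq_pair, braiding_hom_eq_pair]
  simp

end BicategoryOfRelations

/-! ### Predicates and the self-duality of objects -/

namespace BicategoryOfRelations

open scoped ComonObj

variable {C : Type u} [Category.{v} C] [MonoidalCategory C] [BicategoryOfRelations C]
variable {W X Y Z X' Y' : C}

theorem pair_mono {f f' : W ⟶ X} {g g' : W ⟶ Y} (h : f ≤ f') (k : g ≤ g') :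
    pair f g ≤ pair f' g' :=
  comp_mono_left _ (tensor_mono h k)

theorem le_discard (φ : X ⟶ 𝟙_ C) : φ ≤ ε[X] := by
  simpa using lax_discard φ

/-- The conjunction of two predicates. -/
def conj (φ ψ : X ⟶ 𝟙_ C) : X ⟶ 𝟙_ C := pair φ ψ ≫ (λ_ (𝟙_ C)).hom

theorem comp_conj (f : X ⟶ Y) [IsMap f] (φ ψ : Y ⟶ 𝟙_ C) :
    f ≫ conj φ ψ = conj (f ≫ φ) (f ≫ ψ) := by
  simp [conj]

theorem conj_le_left (φ ψ : X ⟶ 𝟙_ C) : conj φ ψ ≤ φ := by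
  refine (comp_mono_right (pair_mono le_rfl (le_discard ψ)) _).trans_eq ?_
  rw [unitors_equal, rightUnitor_hom_eq_fst, pair_fst]

theorem conj_le_right (φ ψ : X ⟶ 𝟙_ C) : conj φ ψ ≤ ψ := by
  refine (comp_mono_right (pair_mono (le_discard φ) le_rfl) _).trans_eq ?_
  rw [leftUnitor_hom_eq_snd, pair_snd]

theorem copy_tensorUnit : Δ[𝟙_ C] = (λ_ (𝟙_ C)).inv := CopyDiscardCategory.copy_unit

/-- Copying on the unit object is invertible, so laxness of copying at `χ` says `χ ≤ conj χ χ`. -/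
theorem le_conj {χ φ ψ : X ⟶ 𝟙_ C} (h : χ ≤ φ) (k : χ ≤ ψ) : χ ≤ conj φ ψ := by
  have h1 := comp_mono_right (lax_copy χ) (λ_ (𝟙_ C)).hom
  rw [copy_tensorUnit, Category.assoc, Iso.inv_hom_id, Category.comp_id] at h1
  exact h1.trans (comp_mono_right (pair_mono h k) _)

theorem conj_comm (φ ψ : X ⟶ 𝟙_ C) : conj φ ψ = conj ψ φ :=
  le_antisymm (le_conj (conj_le_right _ _) (conj_le_left _ _))
    (le_conj (conj_le_right _ _) (conj_le_left _ _))

theorem merge_tensorUnit : merge (𝟙_ C) = (λ_ (𝟙_ C)).hom :=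
  rightAdjoint_unique (f := Δ[𝟙_ C]) (id_le_copy_merge _) (merge_copy_le_id _)
    (by simp [copy_tensorUnit]) (by simp [copy_tensorUnit])

/-- Precomposition with the right adjoint of a map is left adjoint to precomposition with it. -/
theorem rightAdjoint_comp_le_iff {f : X ⟶ Y} {g : Y ⟶ X} (h : 𝟙 X ≤ f ≫ g) (k : g ≫ f ≤ 𝟙 Y)
    {φ : X ⟶ Z} {ψ : Y ⟶ Z} : g ≫ φ ≤ ψ ↔ φ ≤ f ≫ ψ := by
  constructor
  · intro l
    have h1 := comp_mono_right h φ
    rw [Category.id_comp, Category.assoc] at h1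
    exact h1.trans (comp_mono_left f l)
  · intro l
    have h1 := comp_mono_right k ψ
    rw [Category.id_comp, Category.assoc] at h1
    exact (comp_mono_left g l).trans h1

/-- The right adjoint of the second projection. -/
def createLeft (X Y : C) : Y ⟶ X ⊗ Y := (λ_ Y).inv ≫ create X ▷ Y

/-- The right adjoint of the first projection. -/
def createRight (X Y : C) : X ⟶ X ⊗ Y := (ρ_ X).inv ≫ X ◁ create Y

theorem snd_adjoint (X Y : C) : 𝟙 (X ⊗ Y) ≤ snd X Y ≫ createLeft X Y ∧
    createLeft X Y ≫ snd X Y ≤ 𝟙 Y := by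
  have h := tensor_adjoint (id_le_discard_create X) (create_discard_le_id X)
    (f' := 𝟙 Y) (g' := 𝟙 Y) (by simp) (by simp)
  simp only [tensorHom_id] at h
  exact comp_adjoint (f' := (λ_ Y).hom) (g' := (λ_ Y).inv) h.1 h.2 (by simp) (by simp)

theorem fst_adjoint (X Y : C) : 𝟙 (X ⊗ Y) ≤ fst X Y ≫ createRight X Y ∧
    createRight X Y ≫ fst X Y ≤ 𝟙 X := by
  have h := tensor_adjoint (f := 𝟙 X) (g := 𝟙 X) (by simp) (by simp)
    (id_le_discard_create Y) (create_discard_le_id Y)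
  simp only [id_tensorHom] at h
  exact comp_adjoint (f' := (ρ_ X).hom) (g' := (ρ_ X).inv) h.1 h.2 (by simp) (by simp)

/-- The two-way rule for the existential quantifier: composing with `createLeft` quantifies over
`X`, and composing with `snd` weakens. -/
theorem createLeft_comp_le_iff {φ : X ⊗ Y ⟶ Z} {ψ : Y ⟶ Z} :
    createLeft X Y ≫ φ ≤ ψ ↔ φ ≤ snd X Y ≫ ψ :=
  rightAdjoint_comp_le_iff (snd_adjoint X Y).1 (snd_adjoint X Y).2

theorem createRight_whiskerRight_comp_le_iff {φ : (X ⊗ Y) ⊗ W ⟶ Z} {ψ : X ⊗ W ⟶ Z} :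
    createRight X Y ▷ W ≫ φ ≤ ψ ↔ φ ≤ fst X Y ▷ W ≫ ψ := by
  have h := tensor_adjoint (fst_adjoint X Y).1 (fst_adjoint X Y).2
    (f' := 𝟙 W) (g' := 𝟙 W) (by simp) (by simp)
  simp only [tensorHom_id] at h
  exact rightAdjoint_comp_le_iff h.1 h.2

/-- The Beck–Chevalley condition: quantification commutes with substitution, since `create A` and
`f` act on different wires. It therefore needs no assumption that `f` is a map. -/
theorem createLeft_naturality (A : C) (f : X ⟶ Y) :
    createLeft A X ≫ A ◁ f = f ≫ createLeft A Y := by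
  simp [createLeft, ← whisker_exchange]

theorem createLeft_braiding (X Y : C) : createLeft X Y ≫ (β_ X Y).hom = createRight Y X := by
  simp [createLeft, createRight]

theorem createLeft_tensor (X Y Z : C) :
    createLeft X (Y ⊗ Z) = createLeft X Y ▷ Z ≫ (α_ X Y Z).hom := by
  simp [createLeft]

/-- Frobenius reciprocity for the second projection. -/
theorem conj_createLeft_le (φ : Y ⟶ 𝟙_ C) (ψ : X ⊗ Y ⟶ 𝟙_ C) :
    conj φ (createLeft X Y ≫ ψ) = createLeft X Y ≫ conj (snd X Y ≫ φ) ψ := by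
  have h1 : pair (snd X Y) (𝟙 (X ⊗ Y)) =
      X ◁ Δ[Y] ≫ (α_ X Y Y).inv ≫ (β_ X Y).hom ▷ Y ≫ (α_ Y X Y).hom := by
    simp only [copy_eq_pair, whiskerLeft_eq_pair, whiskerRight_eq_pair, associator_hom_eq_pair,
      associator_inv_eq_pair, braiding_hom_eq_pair]
    simp [pair_fst_snd]
  have h2 : createRight Y X ▷ Y ≫ (α_ Y X Y).hom = Y ◁ createLeft X Y := by
    simp [createRight, createLeft]
  -- The pairing on the left only copies the wire `Y`, and this copying slides past the creation of
  -- `X`.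
  have h3 : createLeft X Y ≫ pair (snd X Y) (𝟙 (X ⊗ Y)) = pair (𝟙 Y) (createLeft X Y) := by
    rw [h1, ← Category.assoc, createLeft_naturality, createLeft_tensor]
    simp only [Category.assoc, Iso.hom_inv_id_assoc]
    rw [← Category.assoc (createLeft X Y ▷ Y), ← comp_whiskerRight, createLeft_braiding, h2,
      pair, id_tensorHom]
  have h4 := pair_tensor (snd X Y) (𝟙 (X ⊗ Y)) φ ψ
  have h5 := pair_tensor (𝟙 Y) (createLeft X Y) φ ψ
  simp only [Category.id_comp] at h4 h5
  rw [conj, conj, ← h4, ← h5, ← h3]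
  simp only [Category.assoc]

/-- The equality predicate, the counit of the self-duality of `X`. -/
def cap (X : C) : X ⊗ X ⟶ 𝟙_ C := merge X ≫ ε[X]

/-- The unit of the self-duality of `X`. -/
def cup (X : C) : 𝟙_ C ⟶ X ⊗ X := create X ≫ Δ[X]

/-- This is the Frobenius equation `Δ[X] ▷ X ≫ _ ≫ X ◁ merge X = merge X ≫ Δ[X]` with the second
output discarded. It says that `merge` is the first projection restricted to the diagonal. -/
theorem pair_fst_cap (X : C) : pair (fst X X) (cap X) ≫ (ρ_ X).hom = merge X := by
  have h1 : pair (fst X X) (𝟙 (X ⊗ X)) = Δ[X] ▷ X ≫ (α_ X X X).hom := by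
    simp only [copy_eq_pair, whiskerRight_eq_pair, associator_hom_eq_pair]
    simp [pair_fst_snd]
  have h2 := pair_tensor (fst X X) (𝟙 (X ⊗ X)) (𝟙 X) (cap X)
  rw [Category.id_comp, Category.comp_id, h1] at h2
  rw [← h2, cap, id_tensorHom, whiskerLeft_comp]
  have h3 := frobenius_right X
  have h4 : merge X ≫ Δ[X] ≫ fst X X = merge X := by rw [copy_eq_pair, pair_fst, Category.comp_id]
  rw [← Category.assoc, ← h3] at h4
  simpa [fst] using h4

theorem pair_cap_snd (X : C) : pair (cap X) (snd X X) ≫ (λ_ X).hom = merge X := by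
  have h1 : pair (𝟙 (X ⊗ X)) (snd X X) = X ◁ Δ[X] ≫ (α_ X X X).inv := by
    simp only [copy_eq_pair, whiskerLeft_eq_pair, associator_inv_eq_pair]
    simp [pair_fst_snd]
  have h2 := pair_tensor (𝟙 (X ⊗ X)) (snd X X) (cap X) (𝟙 X)
  rw [Category.id_comp, Category.comp_id, h1] at h2
  rw [← h2, cap, tensorHom_id, comp_whiskerRight]
  have h3 := frobenius_left X
  have h4 : merge X ≫ Δ[X] ≫ snd X X = merge X := by rw [copy_eq_pair, pair_snd, Category.comp_id]
  rw [← Category.assoc, ← h3] at h4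
  simpa [snd] using h4

/-- `merge = merge ≫ Δ ≫ snd ≤ snd`, by the counit of the adjunction. -/
theorem merge_le_snd (X : C) : merge X ≤ snd X X := by
  have := comp_mono_right (merge_copy_le_id X) (snd X X)
  rwa [Category.assoc, copy_eq_pair, pair_snd, Category.comp_id, Category.id_comp] at this

/-- The composite is right adjoint to `Δ[X] ≫ snd X X = 𝟙 X`, hence is the identity. -/
theorem createLeft_merge (X : C) : createLeft X X ≫ merge X = 𝟙 X := by
  have h := comp_adjoint (id_le_copy_merge X) (merge_copy_le_id X) (snd_adjoint X X).1
    (snd_adjoint X X).2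
  rw [copy_eq_pair, pair_snd] at h
  exact rightAdjoint_unique h.1 h.2 (by simp) (by simp)

theorem createRight_merge (X : C) : createRight X X ≫ merge X = 𝟙 X := by
  have h := comp_adjoint (id_le_copy_merge X) (merge_copy_le_id X) (fst_adjoint X X).1
    (fst_adjoint X X).2
  rw [copy_eq_pair, pair_fst] at h
  exact rightAdjoint_unique h.1 h.2 (by simp) (by simp)

/-- Equal maps are interchangeable. -/
theorem conj_eq_comp_le (s t : X ⟶ Y) [IsMap s] [IsMap t] (φ : Y ⟶ 𝟙_ C) :
    conj (pair s t ≫ cap Y) (s ≫ φ) ≤ t ≫ φ := by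
  -- The morphism `s`, restricted to where `s = t`, is `pair s t ≫ merge Y`, which lies below `pair
  -- s t ≫ snd Y Y = t`.
  have h1 : pair s (pair s t ≫ cap Y) ≫ (ρ_ Y).hom ≤ t := by
    have h2 : pair s (pair s t ≫ cap Y) = pair s t ≫ pair (fst Y Y) (cap Y) := by simp
    rw [h2, Category.assoc, pair_fst_cap]
    refine (comp_mono_left _ (merge_le_snd Y)).trans_eq ?_
    simp
  have h3 := pair_tensor s (pair s t ≫ cap Y) φ (𝟙 _)
  rw [conj_comm, conj]
  rw [Category.comp_id] at h3
  rw [← h3, unitors_equal, tensorHom_id, Category.assoc, rightUnitor_naturality, ← Category.assoc]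
  exact comp_mono_right h1 φ

theorem discard_le_eq_self (s : X ⟶ Y) [IsMap s] : ε[X] ≤ pair s s ≫ cap Y := by
  have h1 : pair s s = s ≫ Δ[Y] := by rw [map_copy, pair]
  have h2 := comp_mono_right (comp_mono_left s (id_le_copy_merge Y)) ε[Y]
  rw [Category.comp_id, map_discard] at h2
  rw [h1, cap]
  simpa using h2

/-- The copy inside the cup, followed by the cap, collapses to `merge` by `pair_fst_cap`; what
remains is `createLeft X X ≫ merge X`, the identity. -/
theorem snake_left (X : C) :
    (λ_ X).inv ≫ cup X ▷ X ≫ (α_ X X X).hom ≫ X ◁ cap X ≫ (ρ_ X).hom = 𝟙 X := by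
  have h1 : pair (fst X X) (𝟙 (X ⊗ X)) = Δ[X] ▷ X ≫ (α_ X X X).hom := by
    simp only [copy_eq_pair, whiskerRight_eq_pair, associator_hom_eq_pair]
    simp [pair_fst_snd]
  have h2 := pair_tensor (fst X X) (𝟙 (X ⊗ X)) (𝟙 X) (cap X)
  rw [Category.id_comp, Category.comp_id, h1, id_tensorHom, Category.assoc] at h2
  rw [cup, comp_whiskerRight]
  simp only [Category.assoc]
  have h3 := pair_fst_cap X
  rw [← h2] at h3
  simp only [Category.assoc] at h3
  rw [h3, ← createLeft_merge X, createLeft, Category.assoc]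

theorem snake_right (X : C) :
    (ρ_ X).inv ≫ X ◁ cup X ≫ (α_ X X X).inv ≫ cap X ▷ X ≫ (λ_ X).hom = 𝟙 X := by
  have h1 : pair (𝟙 (X ⊗ X)) (snd X X) = X ◁ Δ[X] ≫ (α_ X X X).inv := by
    simp only [copy_eq_pair, whiskerLeft_eq_pair, associator_inv_eq_pair]
    simp [pair_fst_snd]
  have h2 := pair_tensor (𝟙 (X ⊗ X)) (snd X X) (cap X) (𝟙 X)
  rw [Category.id_comp, Category.comp_id, h1, tensorHom_id, Category.assoc] at h2
  rw [cup, whiskerLeft_comp]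
  simp only [Category.assoc]
  have h3 := pair_cap_snd X
  rw [← h2] at h3
  simp only [Category.assoc] at h3
  rw [h3, ← createRight_merge X, createRight, Category.assoc]

/-- Every object of a bicategory of relations is self-dual. -/
instance exactPairing (X : C) : ExactPairing X X where
  coevaluation' := cup X
  evaluation' := cap X
  coevaluation_evaluation' := by
    have := snake_right X
    rw [Iso.inv_comp_eq] at this
    simp only [← Category.assoc] at this ⊢
    rw [← Iso.eq_comp_inv] at this
    simpa using this
  evaluation_coevaluation' := by
    have := snake_left X
    rw [Iso.inv_comp_eq] at this
    simp only [← Category.assoc] at this ⊢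
    rw [← Iso.eq_comp_inv] at this
    simpa using this

theorem evaluation_eq_cap (X : C) : ε_ X X = cap X := rfl

theorem coevaluation_eq_cup (X : C) : η_ X X = cup X := rfl

/-! ### Morphisms as predicates on inputs and outputs. -/

/-- The predicate on `X ⊗ Y` corresponding to a morphism `X ⟶ Y`. -/
def name (R : X ⟶ Y) : X ⊗ Y ⟶ 𝟙_ C := R ▷ Y ≫ cap Y

/-- The morphism `X ⟶ Y` corresponding to a predicate on `X ⊗ Y`. -/
def bend (φ : X ⊗ Y ⟶ 𝟙_ C) : X ⟶ Y :=
  (ρ_ X).inv ≫ X ◁ cup Y ≫ (α_ X Y Y).inv ≫ φ ▷ Y ≫ (λ_ Y).hom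

@[simp] theorem name_bend (φ : X ⊗ Y ⟶ 𝟙_ C) : name (bend φ) = φ := by
  have h := (tensorRightHomEquiv X Y Y (𝟙_ C)).symm_apply_apply φ
  -- Up to a unitor, `bend` is the bijection `tensorRightHomEquiv` given by the self-duality of `Y`.
  have e : tensorRightHomEquiv X Y Y (𝟙_ C) φ = bend φ ≫ (λ_ Y).inv := by
    simp [tensorRightHomEquiv, bend, ← coevaluation_eq_cup]
  rw [e] at h
  simpa [tensorRightHomEquiv, evaluation_eq_cap, name, ← unitors_equal] using h

@[simp] theorem bend_name (R : X ⟶ Y) : bend (name R) = R := by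
  have h := (tensorRightHomEquiv X Y Y (𝟙_ C)).apply_symm_apply (R ≫ (λ_ Y).inv)
  have e : (tensorRightHomEquiv X Y Y (𝟙_ C)).symm (R ≫ (λ_ Y).inv) = name R := by
    simp [tensorRightHomEquiv, name, evaluation_eq_cap, ← unitors_equal]
  rw [e] at h
  rw [← cancel_mono (λ_ Y).inv, ← h]
  simp [tensorRightHomEquiv, coevaluation_eq_cup, bend]

theorem name_injective {R S : X ⟶ Y} (h : name R = name S) : R = S := by
  rw [← bend_name R, h, bend_name]

theorem bend_mono {φ ψ : X ⊗ Y ⟶ 𝟙_ C} (h : φ ≤ ψ) : bend φ ≤ bend ψ :=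
  comp_mono_left _ (comp_mono_left _ (comp_mono_left _ (comp_mono_right (whiskerRight_mono h _) _)))

theorem name_mono {R S : X ⟶ Y} (h : R ≤ S) : name R ≤ name S :=
  comp_mono_right (whiskerRight_mono h _) _

theorem name_map (f : X ⟶ Y) : name f = pair (fst X Y ≫ f) (snd X Y) ≫ cap Y := by
  rw [name, whiskerRight_eq_pair]

theorem name_comp (R : X ⟶ Y) (S : Y ⟶ Z) : name (R ≫ S) = R ▷ Z ≫ name S := by
  simp [name]

/-- The semantic form of `∃ y. φ(x, y) ∧ S(y, z)`: the copy inside the cup hands the wire `Y` to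
both conjuncts, and its `create` quantifies over it. -/
theorem name_bend_comp (φ : X ⊗ Y ⟶ 𝟙_ C) (S : Y ⟶ Z) : name (bend φ ≫ S) =
    createRight X Y ▷ Z ≫ conj (fst (X ⊗ Y) Z ≫ φ) (snd X Y ▷ Z ≫ name S) := by
  have h1 : pair (𝟙 (X ⊗ Y)) (snd X Y) = X ◁ Δ[Y] ≫ (α_ X Y Y).inv := by
    simp only [copy_eq_pair, whiskerLeft_eq_pair, associator_inv_eq_pair]
    simp [pair_fst_snd]
  have h2 : pair (fst (X ⊗ Y) Z) (snd X Y ▷ Z) =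
      pair (𝟙 (X ⊗ Y)) (snd X Y) ▷ Z ≫ (α_ (X ⊗ Y) Y Z).hom := by
    simp only [whiskerRight_eq_pair, associator_hom_eq_pair]
    simp
  rw [name_comp, conj, ← pair_tensor, h2, h1, bend, createRight, cup,
    MonoidalCategory.tensorHom_def]
  simp

/-- Both sides are right adjoint to `inv g ≫ Δ[X] = Δ[Y] ≫ (inv g ⊗ₘ inv g)`. -/
theorem comp_merge_of_isIso (g : X ⟶ Y) [IsIso g] : (g ⊗ₘ g) ≫ merge Y = merge X ≫ g := by
  have h := comp_adjoint (f := inv g) (g := g) (by simp) (by simp)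
    (id_le_copy_merge X) (merge_copy_le_id X)
  have h' := comp_adjoint (id_le_copy_merge Y) (merge_copy_le_id Y)
    (f' := inv g ⊗ₘ inv g) (g' := g ⊗ₘ g) (by simp) (by simp)
  rw [← map_copy] at h'
  exact rightAdjoint_unique h'.1 h'.2 h.1 h.2

theorem comp_cap_of_isIso (g : X ⟶ Y) [IsIso g] : (g ⊗ₘ g) ≫ cap Y = cap X := by
  rw [cap, ← Category.assoc, comp_merge_of_isIso, Category.assoc, map_discard, cap]

theorem name_comp_of_isIso (R : X ⟶ Y) (g : Y ⟶ Z) [IsIso g] :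
    name (R ≫ g) = X ◁ inv g ≫ name R := by
  rw [name, comp_whiskerRight, ← comp_cap_of_isIso (inv g), Category.assoc, ← tensorHom_id g,
    ← Category.assoc (g ⊗ₘ _), tensorHom_comp_tensorHom, name, whisker_exchange_assoc]
  simp

/-- Uniqueness of adjoints applied to `CopyDiscardCategory.copy_tensor`. The interchange there is
inverted by another interchange, as a comparison of projections shows. -/
theorem merge_tensor (X Y : C) :
    merge (X ⊗ Y) = tensorμ X Y X Y ≫ (merge X ⊗ₘ merge Y) := by
  have h := tensor_adjoint (id_le_copy_merge X) (merge_copy_le_id X) (id_le_copy_merge Y)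
    (merge_copy_le_id Y)
  have e1 : tensorμ X X Y Y ≫ tensorμ X Y X Y = 𝟙 _ := by
    simp only [tensorμ_eq_pair]
    refine map_ext (map_ext ?_ ?_) (map_ext ?_ ?_) <;> simp
  have e2 : tensorμ X Y X Y ≫ tensorμ X X Y Y = 𝟙 _ := by
    simp only [tensorμ_eq_pair]
    refine map_ext (map_ext ?_ ?_) (map_ext ?_ ?_) <;> simp
  have h' := comp_adjoint h.1 h.2 (f' := tensorμ X X Y Y) (g' := tensorμ X Y X Y)
    e1.ge e2.le
  rw [← CopyDiscardCategory.copy_tensor] at h'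
  exact rightAdjoint_unique (id_le_copy_merge _) (merge_copy_le_id _) h'.1 h'.2

theorem cap_tensor (X Y : C) :
    cap (X ⊗ Y) = tensorμ X Y X Y ≫ (cap X ⊗ₘ cap Y) ≫ (λ_ (𝟙_ C)).hom := by
  rw [cap, merge_tensor, Category.assoc, CopyDiscardCategory.discard_tensor]
  simp [cap]

theorem cap_tensorUnit : cap (𝟙_ C) = (λ_ (𝟙_ C)).hom := by
  rw [cap, merge_tensorUnit]; simp

/-- Equality of pairs is componentwise; this is the induction step for equality of tuples of
variables. -/
theorem pair_comp_cap_tensor (f g : W ⟶ X ⊗ Y) [IsMap f] [IsMap g] :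
    pair f g ≫ cap (X ⊗ Y) = conj (pair (f ≫ fst X Y) (g ≫ fst X Y) ≫ cap X)
      (pair (f ≫ snd X Y) (g ≫ snd X Y) ≫ cap Y) := by
  rw [cap_tensor, tensorμ_eq_pair, conj]
  simp only [comp_pair_assoc, pair_fst_assoc, pair_snd_assoc, pair_tensor_assoc]

theorem name_tensor (R : X ⟶ Y) (S : X' ⟶ Y') : name (R ⊗ₘ S) =
    conj (pair (fst (X ⊗ X') (Y ⊗ Y') ≫ fst X X') (snd (X ⊗ X') (Y ⊗ Y') ≫ fst Y Y') ≫ name R)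
      (pair (fst (X ⊗ X') (Y ⊗ Y') ≫ snd X X') (snd (X ⊗ X') (Y ⊗ Y') ≫ snd Y Y') ≫ name S) := by
  rw [name, cap_tensor, ← tensorHom_id, ← id_tensorHom_id, tensorμ_natural_assoc, tensorμ_eq_pair,
    conj, name, name]
  simp only [← tensorHom_id, pair_tensor_assoc, pair_tensor]

end BicategoryOfRelations

/-! ### Soundness of interpretations -/

namespace RegularLogic

open BicategoryOfRelations
open scoped ComonObj

namespace Interpretation

variable {B : Type u} [Category.{v} B] [MonoidalCategory B] [BicategoryOfRelations B]
variable {S : Signature.{u₁, v₁}} (I : Interpretation S B)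
variable {Γ Ψ Θ : List S.Ty} {A : S.Ty} {X : B}

theorem var_zero : I.var (.zero : Var (A :: Γ) A) = fst (I.ty A) (ctxObj I.ty Γ) := rfl

theorem var_succ {A' : S.Ty} (x : Var Γ A) :
    I.var (.succ x : Var (A' :: Γ) A) = snd (I.ty A') (ctxObj I.ty Γ) ≫ I.var x := by
  simp [var, snd]

theorem tuple_cons (x : Ren (A :: Γ) Θ) :
    I.tuple x = pair (I.var (x .zero)) (I.tuple x.tail) := rfl

instance isMap_var (x : Var Γ A) : IsMap (I.var x) := by
  induction x with
  | zero => exact inferInstanceAs (IsMap (fst _ _))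
  | succ x ih => rw [var_succ]; exact inferInstance

instance isMap_tuple (x : Ren Γ Θ) : IsMap (I.tuple x) := by
  induction Γ with
  | nil => exact inferInstanceAs (IsMap ε[_])
  | cons A Γ ih =>
    have := ih x.tail
    rw [tuple_cons]
    infer_instance

@[simp] theorem tuple_var (x : Ren Γ Θ) (z : Var Γ A) : I.tuple x ≫ I.var z = I.var (x z) := by
  induction z with
  | zero => rw [tuple_cons, var_zero, pair_fst]
  | succ z ih =>
    rw [tuple_cons, var_succ]
    exact (pair_snd_assoc _ _ _).trans (ih x.tail)

/-- Maps into the interpretation of a context are determined by their components. -/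
theorem ctx_ext {f g : X ⟶ ctxObj I.ty Γ} [hf : IsMap f] [hg : IsMap g]
    (h : ∀ A (x : Var Γ A), f ≫ I.var x = g ≫ I.var x) : f = g := by
  induction Γ with
  | nil => exact map_unit_ext f g
  | cons A Γ ih =>
    refine map_ext (h _ .zero) ?_
    refine ih fun A' x => ?_
    have := h A' x.succ
    rw [var_succ] at this
    simpa only [Category.assoc] using this

theorem tuple_id (Γ : List S.Ty) : I.tuple (Ren.id Γ) = 𝟙 _ :=
  I.ctx_ext fun A x => by simp

theorem tuple_comp (σ : Ren Γ Ψ) (τ : Ren Ψ Θ) :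
    I.tuple (σ.comp τ) = I.tuple τ ≫ I.tuple σ :=
  I.ctx_ext fun A x => by simp

theorem tuple_wk (A : S.Ty) : I.tuple (Ren.wk (Γ := Γ) A) = snd (I.ty A) (ctxObj I.ty Γ) :=
  I.ctx_ext fun A x => by rw [tuple_var, Ren.wk_apply, var_succ]

theorem tuple_lift (A : S.Ty) (σ : Ren Γ Ψ) :
    I.tuple (σ.lift A) = I.ty A ◁ I.tuple σ := by
  refine I.ctx_ext (hg := inferInstanceAs (IsMap (I.ty A ◁ I.tuple σ))) fun A x => ?_
  rw [tuple_var]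
  cases x with
  | zero => rw [var_zero, whiskerLeft_eq_pair, pair_fst]; rfl
  | succ x =>
    rw [var_succ, whiskerLeft_eq_pair, pair_snd_assoc, Category.assoc, tuple_var]
    exact I.var_succ _

theorem formula_and (φ ψ : Formula S Γ) :
    I.formula (.and φ ψ) = conj (I.formula φ) (I.formula ψ) := by
  rw [formula, merge_tensorUnit, conj, pair, Category.assoc]

theorem formula_eq (x y : Var Γ A) :
    I.formula (.eq x y) = pair (I.var x) (I.var y) ≫ cap (I.ty A) := by
  rw [formula, pair, cap, Category.assoc]

theorem formula_ex (φ : Formula S (A :: Γ)) :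
    I.formula (.ex A φ) = createLeft (I.ty A) (ctxObj I.ty Γ) ≫ I.formula φ := by
  rw [formula, createLeft, Category.assoc]

/-- Tuples of variables are maps, so precomposition with them preserves conjunctions and equalities.
Quantifiers are handled by `createLeft_naturality`, as lifting a substitution leaves the bound wire
alone. -/
theorem formula_subst (σ : Ren Γ Ψ) (φ : Formula S Γ) :
    I.formula (φ.subst σ) = I.tuple σ ≫ I.formula φ := by
  induction φ generalizing Ψ with
  | rel R x => rw [Formula.subst, formula, formula, tuple_comp, Category.assoc]
  | eq x y => rw [Formula.subst, formula_eq, formula_eq, comp_pair_assoc, tuple_var, tuple_var]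
  | top => exact (map_discard _).symm
  | and φ ψ h1 h2 => rw [Formula.subst, formula_and, formula_and, comp_conj, h1, h2]
  | ex A φ ih =>
    rw [Formula.subst, formula_ex, formula_ex, ih, tuple_lift, ← Category.assoc,
      createLeft_naturality, Category.assoc]

theorem formula_eqs (x y : Ren Θ Γ) :
    I.formula (Formula.eqs x y) = pair (I.tuple x) (I.tuple y) ≫ cap (ctxObj I.ty Θ) := by
  induction Θ with
  | nil =>
    -- For the empty tuple, equality is the unitor of the unit object, hence a map; the only map to
    -- the unit object is the discard, which interprets `⊤`.
    refine @eq_discard _ _ _ _ (ctxObj I.ty Γ) _ ?_ |>.symm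
    have h := cap_tensorUnit (C := B)
    change IsMap (pair (I.tuple x) (I.tuple y) ≫ cap (𝟙_ B))
    rw [h]
    have : IsMap (Y := 𝟙_ B) (I.tuple x) := I.isMap_tuple x
    have : IsMap (Y := 𝟙_ B) (I.tuple y) := I.isMap_tuple y
    infer_instance
  | cons A Θ ih =>
    rw [Formula.eqs, formula_and, formula_eq, ih, tuple_cons, tuple_cons]
    refine Eq.trans ?_ (pair_comp_cap_tensor _ _).symm
    rw [pair_fst, pair_fst, pair_snd, pair_snd]

end Interpretation

/-- An interpretation validates a sequent if the interpretations of its sides are ordered. -/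
def Interpretation.IsModel {B : Type u} [Category.{v} B] [MonoidalCategory B]
    [BicategoryOfRelations B] {T : RegularTheory.{u₁, v₁}} (I : Interpretation T.sig B) : Prop :=
  ∀ s ∈ T.ax, I.formula s.hyp ≤ I.formula s.concl

theorem Interpretation.IsModel.sound {B : Type u} [Category.{v} B] [MonoidalCategory B]
    [BicategoryOfRelations B] {T : RegularTheory.{u₁, v₁}} {I : Interpretation T.sig B}
    (hI : I.IsModel) {Γ : List T.sig.Ty} {φ ψ : Formula T.sig Γ} (h : Entails T φ ψ) :
    I.formula φ ≤ I.formula ψ := by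
  induction h with
  | ax hs => exact hI _ hs
  | id φ => exact le_rfl
  | cut _ _ h1 h2 => exact h1.trans h2
  | subst t _ ih =>
    rw [I.formula_subst, I.formula_subst]
    exact comp_mono_left _ ih
  | eq_refl φ x =>
    rw [I.formula_eq]
    exact (le_discard _).trans (discard_le_eq_self _)
  | eq_subst x y φ =>
    rw [I.formula_and, I.formula_eqs, I.formula_subst, I.formula_subst]
    exact conj_eq_comp_le _ _ _
  | top_intro φ => exact le_discard _
  | and_intro _ _ h1 h2 => rw [I.formula_and]; exact le_conj h1 h2
  | and_left φ ψ => rw [I.formula_and]; exact conj_le_left _ _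
  | and_right φ ψ => rw [I.formula_and]; exact conj_le_right _ _
  | ex_elim _ ih =>
    rw [I.formula_ex]
    refine createLeft_comp_le_iff.2 (ih.trans_eq ?_)
    rw [I.formula_subst, I.tuple_wk]
  | ex_unit _ ih =>
    rw [I.formula_ex] at ih
    refine (createLeft_comp_le_iff.1 ih).trans_eq ?_
    rw [I.formula_subst, I.tuple_wk]
  | frobenius φ ψ =>
    rw [I.formula_and, I.formula_ex, I.formula_ex, I.formula_and, I.formula_subst, I.tuple_wk]
    exact (conj_createLeft_le _ _).le

/-- The interpretation of a concatenation of contexts is the tensor product. -/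
def ctxTensor {B : Type u} [Category.{v} B] [MonoidalCategory B] {T : Type u₁} (ty : T → B) :
    ∀ Γ Ψ : List T, ctxObj ty Γ ⊗ ctxObj ty Ψ ≅ ctxObj ty (Γ ++ Ψ)
  | [], Ψ => λ_ (ctxObj ty Ψ)
  | A :: Γ, Ψ => α_ (ty A) (ctxObj ty Γ) (ctxObj ty Ψ) ≪≫
      whiskerLeftIso (ty A) (ctxTensor ty Γ Ψ)

namespace Interpretation

variable {B : Type u} [Category.{v} B] [MonoidalCategory B]
variable [BicategoryOfRelations B]
variable {S : Signature.{u₁, v₁}} (I : Interpretation S B)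
variable {Γ Ψ Θ : List S.Ty} {A : S.Ty} {X : B}

-- Together with `ctxTensor_hom_inr`, this describes `ctxTensor` by its components. Equations of
-- maps into a context can then be checked by `ctx_ext` one variable at a time.
@[simp] theorem ctxTensor_hom_inl (x : Var Γ A) : (ctxTensor I.ty Γ Ψ).hom ≫ I.var (Ren.inl Ψ x) =
    fst (ctxObj I.ty Γ) (ctxObj I.ty Ψ) ≫ I.var x := by
  induction x with
  | zero =>
    rw [var_zero]
    refine Eq.trans (Category.assoc _ _ _) ?_
    simp only [whiskerLeftIso_hom, Ren.inl]
    rw [var_zero, whiskerLeft_eq_pair]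
    erw [pair_fst]
    rw [associator_hom_eq_pair]
    exact pair_fst _ _
  | succ x ih =>
    rw [var_succ]
    refine Eq.trans (Category.assoc _ _ _) ?_
    simp only [whiskerLeftIso_hom, Ren.inl]
    rw [var_succ, whiskerLeft_eq_pair]
    erw [pair_snd_assoc]
    rw [Category.assoc, ih, associator_hom_eq_pair]
    simp only [pair_snd_assoc, pair_fst_assoc, Category.assoc]

@[simp] theorem ctxTensor_hom_inr (x : Var Ψ A) : (ctxTensor I.ty Γ Ψ).hom ≫ I.var (Ren.inr Γ x) =
    snd (ctxObj I.ty Γ) (ctxObj I.ty Ψ) ≫ I.var x := by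
  induction Γ with
  | nil => exact congrArg (· ≫ I.var x) (leftUnitor_hom_eq_snd _)
  | cons A' Γ ih =>
    refine Eq.trans (Category.assoc _ _ _) ?_
    simp only [whiskerLeftIso_hom, Ren.inr]
    rw [var_succ, whiskerLeft_eq_pair]
    erw [pair_snd_assoc]
    rw [Category.assoc, ih, associator_hom_eq_pair]
    simp only [pair_snd_assoc]

theorem tuple_app (σ : Ren Γ Θ) (τ : Ren Ψ Θ) : I.tuple (Ren.app σ τ) =
    pair (I.tuple σ) (I.tuple τ) ≫ (ctxTensor I.ty Γ Ψ).hom :=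
  I.ctx_ext <| Ren.app_cases (by simp) (by simp)

theorem ctxTensor_hom_tuple_inl : (ctxTensor I.ty Γ Ψ).hom ≫ I.tuple (Ren.inl Ψ) =
    fst (ctxObj I.ty Γ) (ctxObj I.ty Ψ) :=
  I.ctx_ext fun _ _ => by simp

theorem ctxTensor_hom_tuple_inr : (ctxTensor I.ty Γ Ψ).hom ≫ I.tuple (Ren.inr Γ) =
    snd (ctxObj I.ty Γ) (ctxObj I.ty Ψ) :=
  I.ctx_ext fun _ _ => by simp

theorem formula_exs_le_iff {φ : Formula S (Θ ++ Γ)} {ψ : ctxObj I.ty Γ ⟶ 𝟙_ B} :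
    I.formula (Formula.exs φ) ≤ ψ ↔ I.formula φ ≤ I.tuple (Ren.inr Θ) ≫ ψ := by
  induction Θ with
  | nil =>
    change I.formula φ ≤ ψ ↔ I.formula φ ≤ I.tuple (Ren.id Γ) ≫ ψ
    rw [tuple_id, Category.id_comp]
  | cons A Θ ih =>
    refine (ih (φ := .ex A φ)).trans ?_
    rw [formula_ex, createLeft_comp_le_iff, ← Category.assoc, ← tuple_wk, ← tuple_comp]
    rfl

end Interpretation

end RegularLogic

/-! ### The functor on the classifying category induced by a model -/

theorem BicategoryOfRelations.comp_le_comp_iff_of_isIso {C : Type u} [Category.{v} C]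
    [MonoidalCategory C] [BicategoryOfRelations C] {X Y Z : C} (e : X ⟶ Y) [IsIso e]
    {φ ψ : Y ⟶ Z} : e ≫ φ ≤ e ≫ ψ ↔ φ ≤ ψ :=
  ⟨fun h => by simpa using comp_mono_left (inv e) h, comp_mono_left e⟩

namespace RegularLogic

open BicategoryOfRelations
open scoped ComonObj

namespace Interpretation

variable {B : Type u} [Category.{v} B] [MonoidalCategory B] [BicategoryOfRelations B]
variable {T : RegularTheory.{u₁, v₁}} (I : Interpretation T.sig B)
variable {Γ₁ Γ₂ Γ₃ Γ₄ : List T.sig.Ty}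

/-- The interpretation of a formula in a context that is divided into inputs and outputs. -/
def hom (φ : Formula T.sig (Γ₁ ++ Γ₂)) : ctxObj I.ty Γ₁ ⟶ ctxObj I.ty Γ₂ :=
  bend ((ctxTensor I.ty Γ₁ Γ₂).hom ≫ I.formula φ)

/-- The name of a morphism is the predicate "its value equals `y`"; for a tuple of variables this is
the interpretation of the graph formula. -/
theorem hom_graphF (f : Ren Γ₂ Γ₁) : I.hom (Cl.graphF f) = I.tuple f := by
  refine name_injective ?_
  rw [hom, name_bend, Cl.graphF, I.formula_eqs, name_map, comp_pair_assoc,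
    I.tuple_comp, ← Category.assoc, I.ctxTensor_hom_tuple_inl, I.ctxTensor_hom_tuple_inr]

variable (Γ₁ Γ₂ Γ₃) in
-- `Cl.compF` puts the quantified context first, whereas `name_bend_comp` has it in the middle. The
-- isomorphism `κ` relates the two orders, and only its two components are ever used.
theorem exists_ctxTensor_middle : ∃ κ : (ctxObj I.ty Γ₁ ⊗ ctxObj I.ty Γ₂) ⊗ ctxObj I.ty Γ₃ ⟶
    ctxObj I.ty (Γ₂ ++ (Γ₁ ++ Γ₃)), IsIso κ ∧
      κ ≫ I.tuple (Ren.inl (Γ₁ ++ Γ₃)) = fst _ _ ≫ snd _ _ ∧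
      κ ≫ I.tuple (Ren.inr Γ₂) = fst _ _ ▷ _ ≫ (ctxTensor I.ty Γ₁ Γ₃).hom := by
  refine ⟨(β_ _ _).hom ▷ _ ≫ (α_ _ _ _).hom ≫
    _ ◁ (ctxTensor I.ty Γ₁ Γ₃).hom ≫ (ctxTensor I.ty Γ₂ (Γ₁ ++ Γ₃)).hom, inferInstance, ?_, ?_⟩
  · simp only [Category.assoc, I.ctxTensor_hom_tuple_inl]
    simp [whiskerLeft_eq_pair, whiskerRight_eq_pair, associator_hom_eq_pair, braiding_hom_eq_pair]
  · simp only [Category.assoc, I.ctxTensor_hom_tuple_inr]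
    simp [whiskerLeft_eq_pair, whiskerRight_eq_pair, associator_hom_eq_pair, braiding_hom_eq_pair]

theorem hom_compF (φ : Formula T.sig (Γ₁ ++ Γ₂)) (ψ : Formula T.sig (Γ₂ ++ Γ₃)) :
    I.hom (Cl.compF φ ψ) = I.hom φ ≫ I.hom ψ := by
  obtain ⟨κ, hκ, κ_inl, κ_inr⟩ := I.exists_ctxTensor_middle Γ₁ Γ₂ Γ₃
  refine name_injective ?_
  rw [hom, hom, hom, name_bend_comp, name_bend, name_bend]
  -- Both sides are existential quantifications, so their upper bounds `χ` are described by
  -- adjunction. Transport along `κ` leaves an equality of the two unquantified conjunctions.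
  refine eq_of_forall_ge_iff fun χ => ?_
  rw [createRight_whiskerRight_comp_le_iff,
    ← comp_le_comp_iff_of_isIso (ctxTensor I.ty Γ₁ Γ₃).inv, Iso.inv_hom_id_assoc, Cl.compF,
    I.formula_exs_le_iff, ← comp_le_comp_iff_of_isIso κ, ← Category.assoc κ (I.tuple _), κ_inr,
    Category.assoc, Iso.hom_inv_id_assoc, I.formula_and, comp_conj, I.formula_subst,
    I.formula_subst, I.tuple_app, I.tuple_app, I.tuple_comp, I.tuple_comp]
  refine iff_of_eq (congrArg (· ≤ fst _ _ ▷ _ ≫ χ) ?_)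
  congr 1
  · rw [Category.assoc, comp_pair_assoc, ← Category.assoc κ, κ_inr, κ_inl, Category.assoc,
      I.ctxTensor_hom_tuple_inl, whiskerRight_eq_pair, pair_fst, ← comp_pair_assoc, pair_fst_snd,
      Category.id_comp]
  · rw [Category.assoc, comp_pair_assoc, ← Category.assoc κ, κ_inr, κ_inl, Category.assoc,
      I.ctxTensor_hom_tuple_inr, whiskerRight_eq_pair, pair_snd, whiskerRight_eq_pair]

theorem ctxTensor_hom_comp_hom_tensorF (φ : Formula T.sig (Γ₁ ++ Γ₂)) (ψ : Formula T.sig (Γ₃ ++ Γ₄)) :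
    (ctxTensor I.ty Γ₁ Γ₃).hom ≫ I.hom (Cl.tensorF φ ψ) =
      (I.hom φ ⊗ₘ I.hom ψ) ≫ (ctxTensor I.ty Γ₂ Γ₄).hom := by
  refine name_injective ?_
  -- Precomposing with the comparison on the outputs cancels the inverse produced by
  -- `name_comp_of_isIso`. Both sides then become conjunctions that agree factor by factor.
  rw [← cancel_epi ((ctxObj I.ty Γ₁ ⊗ ctxObj I.ty Γ₃) ◁ (ctxTensor I.ty Γ₂ Γ₄).hom),
    name_comp_of_isIso (I.hom φ ⊗ₘ I.hom ψ), ← whiskerLeft_comp_assoc, IsIso.hom_inv_id,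
    whiskerLeft_id, Category.id_comp, name_tensor, name_comp, hom, hom, hom, name_bend, name_bend,
    name_bend, Cl.tensorF, I.formula_and, comp_conj, comp_conj, comp_conj, I.formula_subst,
    I.formula_subst, I.tuple_app, I.tuple_app]
  congr 1 <;>
  · rw [whiskerLeft_eq_pair, whiskerRight_eq_pair]
    simp only [I.tuple_comp, comp_pair_assoc, Category.assoc, pair_fst_assoc]
    simp only [← Category.assoc (ctxTensor I.ty _ _).hom, ctxTensor_hom_tuple_inl,
      ctxTensor_hom_tuple_inr]
    simp only [pair_fst_assoc, pair_snd_assoc, pair_snd, Category.assoc, ctxTensor_hom_tuple_inl,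
      ctxTensor_hom_tuple_inr]

variable (Γ₁ Γ₂ Γ₃) in
theorem ctxTensor_associativity :
    (ctxTensor I.ty Γ₁ Γ₂).hom ▷ ctxObj I.ty Γ₃ ≫ (ctxTensor I.ty (Γ₁ ++ Γ₂) Γ₃).hom ≫
      I.tuple (Ren.app ((Ren.inl Γ₂).comp (Ren.inl Γ₃))
        (Ren.app ((Ren.inr Γ₁).comp (Ren.inl Γ₃)) (Ren.inr (Γ₁ ++ Γ₂)))) =
    (α_ _ _ _).hom ≫ ctxObj I.ty Γ₁ ◁ (ctxTensor I.ty Γ₂ Γ₃).hom ≫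
      (ctxTensor I.ty Γ₁ (Γ₂ ++ Γ₃)).hom := by
  refine I.ctx_ext (Ren.app_cases (fun A x => ?_) (Ren.app_cases (fun A x => ?_) fun A x => ?_)) <;>
  simp [whiskerLeft_eq_pair, whiskerRight_eq_pair, associator_hom_eq_pair]

variable (Γ₁ Γ₂) in
theorem ctxTensor_braiding : (ctxTensor I.ty Γ₁ Γ₂).hom ≫
    I.tuple (Ren.app (Ren.inr Γ₁) (Ren.inl Γ₂)) = (β_ _ _).hom ≫ (ctxTensor I.ty Γ₂ Γ₁).hom := by
  rw [tuple_app, comp_pair_assoc, ctxTensor_hom_tuple_inl, ctxTensor_hom_tuple_inr,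
    braiding_hom_eq_pair]

theorem tuple_copy (Γ : List T.sig.Ty) : I.tuple (Ren.app (Ren.id Γ) (Ren.id Γ)) ≫
    (ctxTensor I.ty Γ Γ).inv = Δ[ctxObj I.ty Γ] := by
  rw [tuple_app, tuple_id, Category.assoc, Iso.hom_inv_id, Category.comp_id, copy_eq_pair]

end Interpretation

namespace Interpretation.IsModel

variable {B : Type u} [Category.{v} B] [MonoidalCategory B] [BicategoryOfRelations B]
variable {T : RegularTheory.{u₁, v₁}} {I : Interpretation T.sig B} (hI : I.IsModel)

/-- The functor on the classifying category induced by a model. -/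
def functor : Cl T ⥤ B where
  obj Γ := ctxObj I.ty Γ.ctx
  map R := Quotient.liftOn R I.hom
    fun _ _ h => congrArg (fun φ => bend (_ ≫ φ)) (le_antisymm (hI.sound h.1) (hI.sound h.2))
  map_id Γ := (I.hom_graphF _).trans (I.tuple_id _)
  map_comp R S := by
    induction R using Quotient.ind
    induction S using Quotient.ind
    exact I.hom_compF _ _

theorem functor_map_mono {Γ Γ' : Cl T} {R S : Γ ⟶ Γ'} (h : R ≤ S) :
    hI.functor.map R ≤ hI.functor.map S := by
  induction R using Quotient.ind
  induction S using Quotient.ind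
  exact bend_mono (comp_mono_left _ (hI.sound h))

/-- The associators, unitors, braidings, copies and discards of `Cl T` are all graphs, so this
reduces the monoidal and comonoid axioms of the functor to equations between tuples of variables. -/
theorem functor_map_graph {Γ Γ' : List T.sig.Ty} (f : Ren Γ' Γ) :
    hI.functor.map (Cl.graph f) = I.tuple f := I.hom_graphF f

theorem ctxTensor_hom_comp_functor_map_tensor {Γ₁ Γ₂ Γ₃ Γ₄ : Cl T} (R : Γ₁ ⟶ Γ₂) (S : Γ₃ ⟶ Γ₄) :
    (ctxTensor I.ty Γ₁.ctx Γ₃.ctx).hom ≫ hI.functor.map (R ⊗ₘ S) =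
      (hI.functor.map R ⊗ₘ hI.functor.map S) ≫ (ctxTensor I.ty Γ₂.ctx Γ₄.ctx).hom := by
  induction R using Quotient.ind
  induction S using Quotient.ind
  exact I.ctxTensor_hom_comp_hom_tensorF _ _

/-- The comparison isomorphisms of the functor induced by a model. -/
def coreMonoidal : hI.functor.CoreMonoidal where
  εIso := Iso.refl _
  μIso Γ Γ' := ctxTensor I.ty Γ.ctx Γ'.ctx
  μIso_hom_natural_left {Γ₁ Γ₂} R Γ := by
    have h := hI.ctxTensor_hom_comp_functor_map_tensor R (𝟙 Γ)
    rw [CategoryTheory.Functor.map_id] at h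
    rw [← tensorHom_id, ← tensorHom_id]
    exact h.symm
  μIso_hom_natural_right {Γ₁ Γ₂} Γ R := by
    have h := hI.ctxTensor_hom_comp_functor_map_tensor (𝟙 Γ) R
    rw [CategoryTheory.Functor.map_id] at h
    rw [← id_tensorHom, ← id_tensorHom]
    exact h.symm
  associativity Γ₁ Γ₂ Γ₃ :=
    (congrArg (_ ≫ _ ≫ ·) (hI.functor_map_graph _)).trans
      (I.ctxTensor_associativity Γ₁.ctx Γ₂.ctx Γ₃.ctx)
  left_unitality Γ := by
    refine Eq.symm ((congrArg (_ ≫ _ ≫ ·) (hI.functor_map_graph _)).trans ?_)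
    refine ((congrArg (· ≫ _) (id_whiskerRight _ _)).trans (Category.id_comp _)).trans ?_
    exact I.ctxTensor_hom_tuple_inr.trans (leftUnitor_hom_eq_snd _).symm
  right_unitality Γ := by
    refine Eq.symm ((congrArg (_ ≫ _ ≫ ·) (hI.functor_map_graph _)).trans ?_)
    refine ((congrArg (· ≫ _) (whiskerLeft_id _ _)).trans (Category.id_comp _)).trans ?_
    exact I.ctxTensor_hom_tuple_inl.trans (rightUnitor_hom_eq_fst _).symm

instance : hI.functor.Monoidal := hI.coreMonoidal.toMonoidal

instance : hI.functor.Braided where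
  braided Γ Γ' := (congrArg ((ctxTensor I.ty Γ.ctx Γ'.ctx).hom ≫ ·) (hI.functor_map_graph _)).trans
    (I.ctxTensor_braiding Γ.ctx Γ'.ctx)

instance : StructurePreserving hI.functor where
  map_mono := hI.functor_map_mono
  map_copy Γ := (congrArg (· ≫ (ctxTensor I.ty Γ.ctx Γ.ctx).inv) (hI.functor_map_graph _)).trans
    (I.tuple_copy Γ.ctx)
  map_discard _ := (congrArg (· ≫ 𝟙 _) (hI.functor_map_graph _)).trans (Category.comp_id _)

end Interpretation.IsModel

end RegularLogic

/-! ### Equivalences of bicategories of relations -/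

namespace BicategoryOfRelations

open scoped ComonObj

open Functor.LaxMonoidal Functor.OplaxMonoidal

theorem isMonoidal_inverseMonoidal {C : Type u₁} [Category.{v₁} C] [MonoidalCategory C]
    {D : Type u₂} [Category.{v₂} D] [MonoidalCategory D] (e : C ≌ D) [e.functor.Monoidal] :
    letI := e.inverseMonoidal
    e.IsMonoidal :=
  let := e.inverseMonoidal
  ⟨rfl, fun _ _ => rfl⟩

variable {C : Type u₁} [Category.{v₁} C] [MonoidalCategory C] [BicategoryOfRelations C]
variable {D : Type u₂} [Category.{v₂} D] [MonoidalCategory D] [BicategoryOfRelations D]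
variable (e : C ≌ D)

section

variable [e.functor.Braided] [e.inverse.Monoidal] [e.IsMonoidal]

/-- The functor is faithful, so the equation may be tested on its image. There the monoidal counit
turns it into naturality of the counit at the braiding of `D`. -/
theorem inverse_laxBraided (X Y : D) :
    μ e.inverse X Y ≫ e.inverse.map (β_ X Y).hom = (β_ _ _).hom ≫ μ e.inverse Y X := by
  apply e.functor.map_injective
  rw [← cancel_mono (e.counitIso.hom.app (Y ⊗ X))]
  simp only [CategoryTheory.Functor.map_comp, Category.assoc,
    e.functor_map_μ_inverse_comp_counitIso_hom_app_tensor, Functor.map_braiding,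
    Functor.Monoidal.μ_δ_assoc]
  have h := e.counitIso.hom.naturality (β_ X Y).hom
  dsimp only [Functor.comp_map, Functor.id_map] at h
  rw [h, ← Category.assoc, e.functor_map_μ_inverse_comp_counitIso_hom_app_tensor, Category.assoc]
  simp

/-- The inverse of a braided monoidal equivalence is braided. -/
@[reducible]
def inverseBraided : e.inverse.Braided where
  braided := inverse_laxBraided e

end

/-- The hypothesis `h` is what makes the inverse monotone. For copying and discarding, apply the
functor and use that the components of the counit are isomorphisms, hence maps and so comonoid
homomorphisms. -/
theorem structurePreserving_inverse [e.functor.Braided] [StructurePreserving e.functor]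
    [e.inverse.Braided] [e.IsMonoidal]
    (h : ∀ {X Y : C} {R S : X ⟶ Y}, e.functor.map R ≤ e.functor.map S → R ≤ S) :
    StructurePreserving e.inverse where
  map_mono {X Y R S} hRS := by
    refine h ?_
    simp only [e.fun_inv_map]
    exact comp_mono_left _ (comp_mono_right hRS _)
  map_copy X := by
    rw [← cancel_mono (μ e.inverse X X), Category.assoc, Functor.Monoidal.δ_μ, Category.comp_id]
    apply e.functor.map_injective
    rw [← cancel_mono (e.counitIso.hom.app (X ⊗ X))]
    have h := e.counitIso.hom.naturality Δ[X]
    dsimp only [Functor.comp_map, Functor.id_map] at h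
    rw [h, CategoryTheory.Functor.map_comp, Category.assoc,
      e.functor_map_μ_inverse_comp_counitIso_hom_app_tensor, ← Category.assoc,
      StructurePreserving.map_copy, ← map_copy]
  map_discard X := by
    rw [← cancel_mono (Functor.LaxMonoidal.ε e.inverse), Category.assoc, Functor.Monoidal.η_ε,
      Category.comp_id]
    apply e.functor.map_injective
    rw [← cancel_mono (e.counitIso.hom.app (𝟙_ D))]
    have h := e.counitIso.hom.naturality ε[X]
    dsimp only [Functor.comp_map, Functor.id_map] at h
    rw [h, CategoryTheory.Functor.map_comp, Category.assoc,
      e.functor_map_ε_inverse_comp_counitIso_hom_app, StructurePreserving.map_discard, map_discard]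

/-- A structure-preserving functor that is an equivalence of categories and reflects the order is
an equivalence of bicategories of relations. -/
noncomputable def BiRelEquivalence.ofReflectsOrder [he : e.functor.Braided]
    [StructurePreserving e.functor]
    (h : ∀ {X Y : C} {R S : X ⟶ Y}, e.functor.map R ≤ e.functor.map S → R ≤ S) :
    BiRelEquivalence C D :=
  letI := e.inverseMonoidal
  haveI := isMonoidal_inverseMonoidal e
  letI := inverseBraided e
  { toEquivalence := e
    functor_braided := he
    functor_structurePreserving := inferInstance
    inverse_structurePreserving := structurePreserving_inverse e h }

end BicategoryOfRelations

/-! ### The equivalence between a bicategory of relations and the classifying category of its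
internal language -/

namespace RegularLogic

open BicategoryOfRelations

section Lang

variable (B : Type u) [Category.{v} B] [MonoidalCategory B] [BicategoryOfRelations B]

/-- The canonical interpretation of the internal language. -/
def langModel : Interpretation (Lang B).sig B := langInterpretation B

theorem langModel_isModel : (langModel B).IsModel := fun _ h => h

/-- Completeness holds by fiat, the axioms being all the valid sequents. -/
theorem entails_lang {Γ : List (Lang B).sig.Ty} {φ ψ : Formula (Lang B).sig Γ}
    (h : (langModel B).formula φ ≤ (langModel B).formula ψ) : Entails (Lang B) φ ψ :=
  Entails.ax (s := ⟨Γ, φ, ψ⟩) h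

/-- The functor from the classifying category of the internal language. -/
def langFunctor : Cl (Lang B) ⥤ B := (langModel_isModel B).functor

instance : (langFunctor B).Braided := inferInstanceAs (langModel_isModel B).functor.Braided

instance : StructurePreserving (langFunctor B) :=
  inferInstanceAs (StructurePreserving (langModel_isModel B).functor)

/-- Passing to names undoes the bending and recovers the interpretations of the formulas, up to an
isomorphism that cancels. Faithfulness follows by antisymmetry. -/
theorem langFunctor_reflects {Γ Γ' : Cl (Lang B)} {R S : Γ ⟶ Γ'}
    (h : (langFunctor B).map R ≤ (langFunctor B).map S) : R ≤ S := by
  induction R using Quotient.ind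
  induction S using Quotient.ind
  refine entails_lang B ?_
  have := name_mono (show (langModel B).hom _ ≤ (langModel B).hom _ from h)
  rw [Interpretation.hom, Interpretation.hom, name_bend, name_bend,
    comp_le_comp_iff_of_isIso] at this
  exact this

instance : (langFunctor B).Faithful where
  map_injective h := le_antisymm (langFunctor_reflects B h.le) (langFunctor_reflects B h.ge)

instance : (langFunctor B).Full where
  map_surjective {Γ Γ'} f := by
    -- A preimage of `f` is the atom given by its name, transported to the concatenated context and
    -- applied to the variables in order.
    let Q : (Lang B).sig.Rel := ⟨Γ.ctx ++ Γ'.ctx,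
      (ctxTensor (langModel B).ty Γ.ctx Γ'.ctx).inv ≫ name f⟩
    refine ⟨Cl.Hom.mk Γ.ctx Γ'.ctx (.rel Q (Ren.id _)), ?_⟩
    change (langModel B).hom (Γ₁ := Γ.ctx) (Γ₂ := Γ'.ctx) (.rel Q (Ren.id _)) = f
    refine name_injective ?_
    have h : (langModel B).formula (.rel Q (Ren.id _)) =
        (ctxTensor (langModel B).ty Γ.ctx Γ'.ctx).inv ≫ name f :=
      (congrArg (· ≫ (langModel B).rel Q) ((langModel B).tuple_id _)).trans (Category.id_comp _)
    rw [Interpretation.hom, name_bend]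
    exact (congrArg (_ ≫ ·) h).trans (Iso.hom_inv_id_assoc _ _)

instance : (langFunctor B).EssSurj where
  -- The interpretation of the one-element context is `A ⊗ 𝟙_ B`, whence the right unitor.
  mem_essImage A := ⟨⟨[A]⟩, ⟨ρ_ A⟩⟩

instance : (langFunctor B).IsEquivalence where

instance : (langFunctor B).asEquivalence.functor.Braided :=
  inferInstanceAs (langFunctor B).Braided

instance : StructurePreserving (langFunctor B).asEquivalence.functor :=
  inferInstanceAs (StructurePreserving (langFunctor B))

/-- Every bicategory of relations is equivalent to the classifying category of its internal
language. -/
noncomputable def langEquivalence : BiRelEquivalence (Cl (Lang B)) B :=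
  BiRelEquivalence.ofReflectsOrder (langFunctor B).asEquivalence (langFunctor_reflects B)

end Lang

end RegularLogic

/-! ### Strictness -/

namespace RegularLogic

section

variable {T : Type u} {Γ Γ' Θ : List T} {A : T}

/-- Reassociated contexts are only propositionally equal, so the claim that a variable keeps its
position is heterogeneous. The successor and zero cases drive the inductions for `inl` and `inr`. -/
theorem Var.succ_heq {x : Var Γ A} {y : Var Γ' A} (B : T) (h : Γ = Γ') (hxy : x ≍ y) :
    (x.succ : Var (B :: Γ) A) ≍ (y.succ : Var (B :: Γ') A) := by
  subst h; subst hxy; rfl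

theorem Var.zero_heq (h : Γ = Γ') :
    (.zero : Var (A :: Γ) A) ≍ (.zero : Var (A :: Γ') A) := by
  subst h; rfl

theorem Ren.inl_inl_heq (x : Var Γ A) :
    Ren.inl Θ (Ren.inl Γ' x) ≍ Ren.inl (Γ' ++ Θ) x := by
  induction x with
  | zero => exact Var.zero_heq (List.append_assoc _ _ _)
  | succ x ih => exact Var.succ_heq _ (List.append_assoc _ _ _) ih

theorem Ren.inl_inr_heq (x : Var Γ' A) :
    Ren.inl Θ (Ren.inr Γ x) ≍ Ren.inr Γ (Ren.inl Θ x) := by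
  induction Γ with
  | nil => rfl
  | cons B Γ ih => exact Var.succ_heq _ (List.append_assoc _ _ _) ih

theorem Ren.inr_heq (x : Var Θ A) : Ren.inr (Γ ++ Γ') x ≍ Ren.inr Γ (Ren.inr Γ' x) := by
  induction Γ with
  | nil => rfl
  | cons B Γ ih => exact Var.succ_heq _ (List.append_assoc _ _ _) ih

theorem Ren.inl_nil_heq (x : Var Γ A) : Ren.inl [] x ≍ x := by
  induction x with
  | zero => exact Var.zero_heq (List.append_nil _)
  | succ x ih => exact Var.succ_heq _ (List.append_nil _) ih

end

namespace Cl

/-- A substitution that keeps every position becomes the identity once the contexts are identified,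
and the graph of the identity is the identity morphism. -/
theorem graph_eq_eqToHom {T : RegularTheory.{u, v}} {Γ Γ' : Cl T} (h : Γ = Γ')
    (f : Ren Γ'.ctx Γ.ctx) (hf : ∀ S (x : Var Γ'.ctx S), f x ≍ x) : graph f = eqToHom h := by
  subst h
  rw [show f = Ren.id Γ.ctx from Ren.ext' fun S x => eq_of_heq (hf S x)]
  rfl

/-- The classifying category of a regular theory is strict monoidal. -/
instance (T : RegularTheory.{u, v}) : IsStrictMonoidal (Cl T) where
  tensor_assoc X Y Z := Cl.ext (List.append_assoc _ _ _)
  unit_tensor X := rfl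
  tensor_unit X := Cl.ext (List.append_nil _)
  associator_hom X Y Z := graph_eq_eqToHom (Cl.ext (List.append_assoc _ _ _)) _ <|
    Ren.app_cases (fun S x => by simpa using Ren.inl_inl_heq x) <|
      Ren.app_cases (fun S x => by simpa using Ren.inl_inr_heq x)
        fun S x => by simpa using Ren.inr_heq x
  leftUnitor_hom X := rfl
  rightUnitor_hom X := graph_eq_eqToHom (Cl.ext (List.append_nil _)) _ fun S x =>
    Ren.inl_nil_heq x

end Cl

/-- The equality of objects is needed to state the equality of morphisms, so the induction carries
both. Each step adds a strict associator and whiskers an `eqToHom`. -/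
theorem ctxTensor_hom_eq_eqToHom {B : Type u} [Category.{v} B] [MonoidalCategory B]
    [IsStrictMonoidal B] {T : Type u₁} (ty : T → B) (Γ Γ' : List T) :
    ∃ h : ctxObj ty Γ ⊗ ctxObj ty Γ' = ctxObj ty (Γ ++ Γ'),
      (ctxTensor ty Γ Γ').hom = eqToHom h := by
  induction Γ with
  | nil => exact ⟨IsStrictMonoidal.unit_tensor _, IsStrictMonoidal.leftUnitor_hom _⟩
  | cons A Γ ih =>
    obtain ⟨h, ih⟩ := ih
    refine ⟨(IsStrictMonoidal.tensor_assoc _ _ _).trans (congrArg (ty A ⊗ ·) h), ?_⟩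
    rw [ctxTensor, Iso.trans_hom, whiskerLeftIso_hom, ih, IsStrictMonoidal.associator_hom,
      whiskerLeft_eqToHom, eqToHom_trans]

instance isStrictMonoidalFunctor_langFunctor (B : Type u) [Category.{v} B] [MonoidalCategory B]
    [BicategoryOfRelations B] [IsStrictMonoidal B] : IsStrictMonoidalFunctor (langFunctor B) where
  obj_unit := rfl
  obj_tensor X Y := (ctxTensor_hom_eq_eqToHom (langModel B).ty X.ctx Y.ctx).1
  ε_eq := rfl
  μ_eq X Y := (ctxTensor_hom_eq_eqToHom (langModel B).ty X.ctx Y.ctx).2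

end RegularLogic

theorem mainTheorem1 (B : Type u) [Category.{v} B] [MonoidalCategory B]
    [BicategoryOfRelations B] :
    IsStrictMonoidal (RegularLogic.Cl (RegularLogic.Lang B)) ∧
    ∃ e : BicategoryOfRelations.BiRelEquivalence (RegularLogic.Cl (RegularLogic.Lang B)) B,
      IsStrictMonoidal B → IsStrictMonoidalFunctor e.toEquivalence.functor :=
  ⟨inferInstance, RegularLogic.langEquivalence B,
    -- The functor underlying `langEquivalence` is `langFunctor B` by definition, with the same
    -- monoidal structure.
    fun _ => RegularLogic.isStrictMonoidalFunctor_langFunctor B⟩
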